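/- Let $F$ be a non-archimedean local field of characteristic zero, with ring of integers $\mathfrak o$ and maximal ideal $\mathfrak p$, let $n\ge 2$, $G=\mathrm{GL}_n(F)$, and let $\psi:F\to\mathbb C^\times$ be an additive character of level one (trivial on $\mathfrak p$, nontrivial on $\mathfrak o$). Let $Z\cong F^\times$ be the center of $G$, $U$ the group of upper triangular unipotent matrices with character $\psi_U(u)=\psi(\sum_{i=1}^{n-1}u_{i,i+1})$, $P_n$ the mirabolic subgroup (last row $(0,\dots,0,1)$), and $I^+$ the group of matrices in $\mathrm{GL}_n(\mathfrak o)$ whose reduction mod $\mathfrak p$ is upper triangular unipotent. For a uniformizer $\varpi$, a character $\omega$ of $Z$ trivial on $1+\mathfrak p$, and $\zeta\in\mathbb C^\times$ with $\zeta^n=\omega(\varpi)$, let $g_\varpi$ be the matrix with entries $1$ directly above the diagonal, $\varpi$ in the lower left corner, and $0$ elsewhere; let $H'=\langle g_\varpi\rangle ZI^+$, let $\chi_{\varpi,\zeta}$ be the character $$\chi_{\varpi,\zeta}(g_\varpi^j z k)=\zeta^j\,\omega(z)\,\psi\Big(\sum_{i=1}^{n-1}k_{i,i+1}+\varpi^{-1}k_{n,1}\Big)\qquad(j\in\mathbb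 Z,\ z\in Z,\ k\in I^+)$$ of $H'$, and let $\pi_{\varpi,\zeta}=\mathrm{ind}_{H'}^G\chi_{\varpi,\zeta}$ (smooth compact induction). A representation of $G$ is called simple supercuspidal if it is isomorphic to some $\pi_{\varpi,\zeta}$ (for some $\omega$). Let $W_{\varpi,\zeta}:G\to\mathbb C$ be the function with $W_{\varpi,\zeta}(uh)=\psi_U(u)\chi_{\varpi,\zeta}(h)$ for $u\in U$, $h\in H'$, and $W_{\varpi,\zeta}=0$ off $UH'$. A Whittaker function for a representation $(\pi,V)$ is a function $g\mapsto l(\pi(g)v)$ with $v\in V$ and $l$ a nonzero linear functional on $V$ satisfying $l(\pi(u)v)=\psi_U(u)l(v)$ for all $u\in U$ and $v\in V$. For an open subgroup $K\supseteq Z$ with $K/Z$ compact, a nonzero Whittaker function $W$ for $\pi$ is $K$-special if its support is contained in $UK$ and $W(k^{-1})=\overline{W(k)}$ for all $k\in K$. A pair $(W_1,W_2)$ of Whittaker functions for $(\pi_1,\pi_2)$ is a special pair if there is such a $K$ for which both are $K$-special, and $W_1(p)=W_2(p)$ for all $p\in P_n$. Theorem. (a) Let $\omega$ be a unitary character of $F^\times$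 trivial on $1+\mathfrak p$, and for $i=1,2$ let $\varpi_i$ be a uniformizer and $\zeta_i^n=\omega(\varpi_i)$. Then, with $K=\langle g_{\varpi_1},g_{\varpi_2}\rangle ZI^+$ (an open subgroup, compact modulo $Z$), $W_{\varpi_i,\zeta_i}$ is a $K$-special Whittaker function for $\pi_{\varpi_i,\zeta_i}$ for $i=1,2$, and $W_{\varpi_1,\zeta_1}(p)=W_{\varpi_2,\zeta_2}(p)$ for all $p\in P_n$; in particular $(W_{\varpi_1,\zeta_1},W_{\varpi_2,\zeta_2})$ is a special pair for $(\pi_{\varpi_1,\zeta_1},\pi_{\varpi_2,\zeta_2})$. (b) Every pair $(\pi_1,\pi_2)$ of irreducible unitarizable simple supercuspidal representations of $G$ with the same central character admits a special pair of Whittaker functions. -/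

import Mathlib

set_option linter.unusedSectionVars false
open ValuativeRel

namespace SimpleSC

noncomputable section

/-! ## Subgroups of `GL n` -/

/-- The group `U` of upper triangular unipotent matrices. -/
def upperUnipotent (n : ℕ) (R : Type*) [CommRing R] : Subgroup (GL (Fin n) R) where
  carrier := {g | ∀ i j, j ≤ i → g i j = (1 : Matrix (Fin n) (Fin n) R) i j}
  one_mem' := fun _ _ _ => rfl
  mul_mem' := by
    intro a b ha hb i j hij
    have hz : ∀ l, l ≠ i → a i l * b l j = 0 := by
      intro l hl
      rcases lt_or_gt_of_ne hl with h | h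
      · rw [ha i l h.le, Matrix.one_apply_ne hl.symm, zero_mul]
      · rw [hb l j (hij.trans h.le), Matrix.one_apply_ne (hij.trans_lt h).ne', mul_zero]
    change ((a : Matrix (Fin n) (Fin n) R) * (b : Matrix (Fin n) (Fin n) R)) i j = _
    rw [Matrix.mul_apply, Finset.sum_eq_single i (fun l _ => hz l) (by simp), ha i i le_rfl,
      hb i j hij, Matrix.one_apply_eq, one_mul]
  inv_mem' := by
    intro a ha
    have hb : ((a⁻¹ : GL (Fin n) R) : Matrix (Fin n) (Fin n) R).BlockTriangular id := by
      rw [Matrix.GeneralLinearGroup.coe_inv]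
      have : Invertible (a : Matrix (Fin n) (Fin n) R) := Units.invertible a
      apply Matrix.blockTriangular_inv_of_blockTriangular
      intro i j hij
      exact (ha i j (le_of_lt hij)).trans (Matrix.one_apply_ne (ne_of_gt hij))
    intro i j hij
    rcases hij.lt_or_eq with h | rfl
    · rw [Matrix.one_apply_ne h.ne']
      exact hb h
    · have h1 : ((a : Matrix (Fin n) (Fin n) R) * ((a⁻¹ : GL (Fin n) R) : Matrix (Fin n) (Fin n) R)) j j =
          (1 : Matrix (Fin n) (Fin n) R) j j := by
        rw [← Matrix.GeneralLinearGroup.coe_mul, mul_inv_cancel]; rfl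
      rw [Matrix.mul_apply, Finset.sum_eq_single j _ (by simp), ha j j le_rfl,
        Matrix.one_apply_eq, one_mul] at h1
      · rw [h1, Matrix.one_apply_eq]
      · intro l _ hl
        rcases lt_or_gt_of_ne hl with h | h
        · rw [ha j l h.le, Matrix.one_apply_ne hl.symm, zero_mul]
        · rw [hb h, mul_zero]

/-- The mirabolic subgroup `P_n` (as a set): matrices with last row `(0, …, 0, 1)`. -/
def mirabolic (n : ℕ) (R : Type*) [CommRing R] : Set (GL (Fin n) R) :=
  {g | ∀ i : Fin n, (i : ℕ) + 1 = n → ∀ j, g i j = (1 : Matrix (Fin n) (Fin n) R) i j}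

section Field

variable {F : Type*} [Field F] [ValuativeRel F] {n : ℕ}

/-- `I⁺`, the pro-unipotent radical of the standard Iwahori subgroup: the matrices in `GL_n(𝔬)`
whose reduction modulo `𝔭` is upper triangular unipotent. Here `(valuation F).integer` is `𝔬`. -/
def iwahoriPlus (n : ℕ) (F : Type*) [Field F] [ValuativeRel F] : Subgroup (GL (Fin n) F) :=
  ((upperUnipotent n (IsLocalRing.ResidueField (valuation F).integer)).comap
    (Matrix.GeneralLinearGroup.map (IsLocalRing.residue (valuation F).integer))).map
      (Matrix.GeneralLinearGroup.map (valuation F).integer.subtype)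

theorem residue_eq_zero_iff (x : (valuation F).integer) :
    IsLocalRing.residue (valuation F).integer x = 0 ↔ valuation F (x : F) < 1 := by
  rw [IsLocalRing.residue_eq_zero_iff, IsLocalRing.mem_maximalIdeal, mem_nonunits_iff,
    Valuation.Integer.not_isUnit_iff_valuation_lt_one]

/-- Entrywise description of `I⁺`. -/
theorem mem_iwahoriPlus (k : GL (Fin n) F) : k ∈ iwahoriPlus n F ↔
    (∀ i j, valuation F (k i j) ≤ 1) ∧
      ∀ i j, j ≤ i → valuation F (k i j - (1 : Matrix (Fin n) (Fin n) F) i j) < 1 := by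
  have key : ∀ (M : Matrix (Fin n) (Fin n) (valuation F).integer) (i j : Fin n),
      IsLocalRing.residue _ (M i j) = (1 : Matrix (Fin n) (Fin n) _) i j ↔
        valuation F ((M i j : F) - (1 : Matrix (Fin n) (Fin n) F) i j) < 1 := by
    intro M i j
    have : (1 : Matrix (Fin n) (Fin n) (IsLocalRing.ResidueField (valuation F).integer)) i j =
        IsLocalRing.residue _ ((1 : Matrix (Fin n) (Fin n) (valuation F).integer) i j) := by
      simp only [Matrix.one_apply]; split_ifs <;> simp
    rw [this, ← sub_eq_zero, ← map_sub, residue_eq_zero_iff]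
    have : (((1 : Matrix (Fin n) (Fin n) (valuation F).integer) i j : (valuation F).integer) : F) =
        (1 : Matrix (Fin n) (Fin n) F) i j := by
      simp only [Matrix.one_apply]; split_ifs <;> simp
    rw [← this]; rfl
  constructor
  · rintro ⟨k, hk, rfl⟩
    refine ⟨fun i j => (k i j).2, fun i j hij => ?_⟩
    exact (key _ i j).1 (hk i j hij)
  · rintro ⟨h1, h2⟩
    let M : Matrix (Fin n) (Fin n) (valuation F).integer := fun i j => ⟨k i j, h1 i j⟩
    have hM : ∀ i j, j ≤ i →
        IsLocalRing.residue _ (M i j) = (1 : Matrix (Fin n) (Fin n) _) i j :=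
      fun i j hij => (key M i j).2 (h2 i j hij)
    have hdet : IsUnit M.det := by
      have h : IsLocalRing.residue _ M.det = 1 := by
        rw [RingHom.map_det, Matrix.det_of_isUpperTriangular]
        · apply Finset.prod_eq_one
          intro i _
          exact (hM i i le_rfl).trans (Matrix.one_apply_eq i)
        · intro i j hij
          exact (hM i j (le_of_lt hij)).trans (Matrix.one_apply_ne (ne_of_gt hij))
      by_contra hu
      have := (IsLocalRing.residue_eq_zero_iff M.det).2 hu
      rw [h] at this
      exact one_ne_zero this
    refine ⟨Matrix.GeneralLinearGroup.mk'' M hdet, fun i j hij => hM i j hij, ?_⟩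
    apply Matrix.GeneralLinearGroup.ext
    intro i j
    rfl

end Field

/-! ## Compact induction -/

section Induction

variable {G : Type*} [Group G] [TopologicalSpace G] [IsTopologicalGroup G]

/-- The space of the compactly induced representation `ind_H^G χ`: functions `f : G → ℂ` with
`f (h g) = χ h * f g`, invariant on the right under some open subgroup, and with support contained
in `H C` for some compact set `C`. -/
def compactInd (H : Subgroup G) (χ : H →* ℂ) : Submodule ℂ (G → ℂ) where
  carrier := {f | (∀ (h : H) (g : G), f (h * g) = χ h * f g) ∧
    (∃ L : Subgroup G, IsOpen (L : Set G) ∧ ∀ g, ∀ k ∈ L, f (g * k) = f g) ∧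
    ∃ C : Set G, IsCompact C ∧ ∀ g, f g ≠ 0 → ∃ h ∈ H, ∃ c ∈ C, g = h * c}
  zero_mem' := ⟨by simp, ⟨⊤, isOpen_univ, by simp⟩, ∅, isCompact_empty, by simp⟩
  add_mem' := by
    rintro f f' ⟨h1, ⟨L, hL, h2⟩, C, hC, h3⟩ ⟨h1', ⟨L', hL', h2'⟩, C', hC', h3'⟩
    refine ⟨fun h g => ?_, ⟨L ⊓ L', hL.inter hL', fun g k hk => ?_⟩, C ∪ C', hC.union hC',
      fun g hg => ?_⟩
    · simp only [Pi.add_apply, h1, h1', mul_add]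
    · simp only [Pi.add_apply, h2 g k hk.1, h2' g k hk.2]
    · by_cases hf : f g = 0
      · have hf' : f' g ≠ 0 := fun h => hg (by simp [hf, h])
        obtain ⟨h, hh, c, hc, e⟩ := h3' g hf'
        exact ⟨h, hh, c, Or.inr hc, e⟩
      · obtain ⟨h, hh, c, hc, e⟩ := h3 g hf
        exact ⟨h, hh, c, Or.inl hc, e⟩
  smul_mem' := by
    rintro a f ⟨h1, ⟨L, hL, h2⟩, C, hC, h3⟩
    refine ⟨fun h g => ?_, ⟨L, hL, fun g k hk => ?_⟩, C, hC, fun g hg => h3 g fun h => hg ?_⟩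
    · simp only [Pi.smul_apply, h1, smul_eq_mul]; ring
    · simp only [Pi.smul_apply, h2 g k hk]
    · simp [h]

theorem compactInd_translate {H : Subgroup G} {χ : H →* ℂ} {f : G → ℂ} (hf : f ∈ compactInd H χ)
    (x : G) : (fun g => f (g * x)) ∈ compactInd H χ := by
  obtain ⟨h1, ⟨L, hL, h2⟩, C, hC, h3⟩ := hf
  refine ⟨fun h g => ?_, ⟨L.map (MulAut.conj x).toMonoidHom, ?_, ?_⟩,
    (fun c => c * x⁻¹) '' C, hC.image (continuous_mul_const _), fun g hg => ?_⟩
  · simp only [mul_assoc, h1]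
  · rw [Subgroup.coe_map]
    exact ((Homeomorph.mulLeft x).trans (Homeomorph.mulRight x⁻¹)).isOpenMap _ hL
  · rintro g _ ⟨k, hk, rfl⟩
    have := h2 (g * x) k hk
    change f (g * (x * k * x⁻¹) * x) = f (g * x)
    rw [← this]
    simp [mul_assoc]
  · obtain ⟨h, hh, c, hc, e⟩ := h3 _ hg
    exact ⟨h, hh, c * x⁻¹, ⟨c, hc, rfl⟩, by rw [← mul_assoc, ← e]; simp⟩

/-- The compactly induced representation `ind_H^G χ`: right translation on `compactInd H χ`. -/
def compactIndRep (H : Subgroup G) (χ : H →* ℂ) : Representation ℂ G (compactInd H χ) where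
  toFun x :=
    { toFun := fun f => ⟨fun g => f.1 (g * x), compactInd_translate f.2 x⟩
      map_add' := fun _ _ => rfl
      map_smul' := fun _ _ => rfl }
  map_one' := by ext f g; simp
  map_mul' x y := by ext f g; simp [mul_assoc]

end Induction

/-! ## Affine generic characters -/

section Affine

variable {F : Type*} [Field F] [ValuativeRel F] {n : ℕ} [n.AtLeastTwo]

/-- `ϖ` generates the maximal ideal `𝔭`. -/
def IsUniformizer (ϖ : Fˣ) : Prop :=
  ∀ x : F, valuation F x < 1 ↔ valuation F x ≤ valuation F (ϖ : F)

/-- The additive character `ψ` has level one: it is trivial on `𝔭` and not trivial on `𝔬`. -/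
def IsLevelOne (ψ : AddChar F ℂ) : Prop :=
  (∀ x : F, valuation F x < 1 → ψ x = 1) ∧ ∃ x : F, valuation F x ≤ 1 ∧ ψ x ≠ 1

/-- The weights `(ϖ, 1, …, 1)`. -/
def weight (ϖ : Fˣ) (j : Fin n) : F := if j = 0 then (ϖ : F) else 1

theorem weight_ne_zero (ϖ : Fˣ) (j : Fin n) : weight ϖ j ≠ 0 := by
  unfold weight; split_ifs <;> simp

/-- The matrix `g_ϖ` with entries `1` right above the diagonal, `ϖ` in the lower left corner and
`0` elsewhere. The indices in `Fin n` are cyclic, so `i + 1 = 0` when `i` is the last index. -/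
def gMat (n : ℕ) [n.AtLeastTwo] (ϖ : Fˣ) : GL (Fin n) F where
  val := Matrix.of fun i j => if j = i + 1 then weight ϖ j else 0
  inv := Matrix.of fun i j => if i = j + 1 then (weight ϖ i)⁻¹ else 0
  val_inv := by
    ext i j
    rw [Matrix.mul_apply, Finset.sum_eq_single (i + 1) (by intro l _ hl; simp [hl]) (by simp)]
    by_cases h : i = j
    · subst h; simp [weight_ne_zero]
    · simp [h]
  inv_val := by
    ext i j
    rw [Matrix.mul_apply, Finset.sum_eq_single (i - 1) (by
      intro l _ hl
      have : i ≠ l + 1 := fun e => hl (by rw [e]; simp)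
      simp [this]) (by simp)]
    by_cases h : i = j
    · subst h; simp [weight_ne_zero]
    · simp [h, Ne.symm h]

/-- For `k` in `I⁺` written as in the definition of an affine generic character, with entries
`r_1, …, r_{n-1}` right above the diagonal and `ϖ r_n` in the lower left corner, this is
`r_1 + ⋯ + r_n`. -/
def affineSum (ϖ : Fˣ) (k : GL (Fin n) F) : F := ∑ i : Fin n, k i (i + 1) / weight ϖ (i + 1)

/-- The standard character `ψ_U(u) = ψ(u_{1,2} + ⋯ + u_{n-1,n})`. -/
def psiU (ψ : AddChar F ℂ) (u : GL (Fin n) F) : ℂ :=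
  ψ (∑ i : Fin n, if i + 1 = 0 then 0 else u i (i + 1))

/-- The embedding of `Fˣ` onto the center `Z`. -/
abbrev zMat (n : ℕ) (z : Fˣ) : GL (Fin n) F := Matrix.GeneralLinearGroup.scalar (Fin n) z

theorem zMat_mul_apply (z : Fˣ) (k : GL (Fin n) F) (i j : Fin n) :
    (zMat n z * k : GL (Fin n) F) i j = z * k i j := by
  change ((Matrix.scalar (Fin n) (z : F)) * (k : Matrix (Fin n) (Fin n) F)) i j = _
  simp [Matrix.scalar_apply, Matrix.diagonal_mul]

theorem zMat_comm (z : Fˣ) (k : GL (Fin n) F) : zMat n z * k = k * zMat n z :=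
  Matrix.GeneralLinearGroup.scalar_commute z k

theorem gMat_mul_apply (ϖ : Fˣ) (k : GL (Fin n) F) (i j : Fin n) :
    (gMat n ϖ * k : GL (Fin n) F) i j = weight ϖ (i + 1) * k (i + 1) j := by
  change ((gMat n ϖ : Matrix (Fin n) (Fin n) F) * (k : Matrix (Fin n) (Fin n) F)) i j = _
  rw [Matrix.mul_apply, Finset.sum_eq_single (i + 1)]
  · simp [gMat]
  · intro l _ hl; simp [gMat, hl]
  · simp

open scoped Fin.CommRing in
theorem gMat_pow_mul_apply (ϖ : Fˣ) (k : GL (Fin n) F) (m : ℕ) (i j : Fin n) :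
    (gMat n ϖ ^ m * k : GL (Fin n) F) i j =
      (∏ t ∈ Finset.range m, weight ϖ (i + ((t + 1 : ℕ) : Fin n))) * k (i + (m : Fin n)) j := by
  induction m generalizing i with
  | zero => simp
  | succ m ih =>
    rw [pow_succ', mul_assoc, gMat_mul_apply, ih, Finset.prod_range_succ', ← mul_assoc]
    congr 1
    · rw [mul_comm]
      congr 1
      · apply Finset.prod_congr rfl
        intro t _
        congr 1
        push_cast
        abel
    · have e : i + 1 + (m : Fin n) = i + ((m + 1 : ℕ) : Fin n) := by push_cast; ring
      rw [e]

open scoped Fin.CommRing in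
theorem gMat_pow_n (ϖ : Fˣ) : gMat n ϖ ^ n = zMat n ϖ := by
  apply Matrix.GeneralLinearGroup.ext
  intro i j
  have h := gMat_pow_mul_apply ϖ (1 : GL (Fin n) F) n i j
  have h' := zMat_mul_apply ϖ (1 : GL (Fin n) F) i j
  rw [mul_one] at h h'
  rw [h, h']
  congr 1
  · rw [Finset.prod_range (fun t => weight ϖ (i + ((t + 1 : ℕ) : Fin n)))]
    have : ∀ t : Fin n, weight ϖ (i + (((t : ℕ) + 1 : ℕ) : Fin n)) =
        weight ϖ (Equiv.addLeft (i + 1) t) := by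
      intro t
      congr 1
      rw [Equiv.coe_addLeft]
      push_cast
      abel
    rw [Finset.prod_congr rfl (fun t _ => this t), Equiv.prod_comp (Equiv.addLeft (i + 1))]
    simp [weight]
  · simp

theorem conj_gMat_apply (ϖ : Fˣ) (k : GL (Fin n) F) (i j : Fin n) :
    (gMat n ϖ * k * (gMat n ϖ)⁻¹ : GL (Fin n) F) i j =
      weight ϖ (i + 1) * k (i + 1) (j + 1) / weight ϖ (j + 1) := by
  change (((gMat n ϖ * k : GL (Fin n) F) : Matrix (Fin n) (Fin n) F) *
    (((gMat n ϖ)⁻¹ : GL (Fin n) F) : Matrix (Fin n) (Fin n) F)) i j = _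
  rw [Matrix.mul_apply, Finset.sum_eq_single (j + 1)]
  · rw [gMat_mul_apply]
    have : (((gMat n ϖ)⁻¹ : GL (Fin n) F) : Matrix (Fin n) (Fin n) F) (j + 1) j =
      (weight ϖ (j + 1))⁻¹ := by
      change (if j + 1 = j + 1 then (weight ϖ (j + 1))⁻¹ else 0) = _
      simp
    rw [this, div_eq_mul_inv]
  · intro l _ hl
    have : (((gMat n ϖ)⁻¹ : GL (Fin n) F) : Matrix (Fin n) (Fin n) F) l j = 0 := by
      change (if l = j + 1 then (weight ϖ l)⁻¹ else 0) = _
      simp [hl]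
    rw [this, mul_zero]
  · simp

theorem affineSum_conj (ϖ : Fˣ) (k : GL (Fin n) F) :
    affineSum ϖ (gMat n ϖ * k * (gMat n ϖ)⁻¹) = affineSum ϖ k := by
  unfold affineSum
  rw [← Equiv.sum_comp (Equiv.addRight (1 : Fin n)) (fun i => k i (i + 1) / weight ϖ (i + 1))]
  apply Finset.sum_congr rfl
  intro i _
  rw [conj_gMat_apply, Equiv.coe_addRight]
  have h1 := weight_ne_zero ϖ (i + 1)
  have h2 := weight_ne_zero ϖ (i + 1 + 1)
  field_simp

theorem fin_succ_val (hn : 2 ≤ n) (i : Fin n) :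
    ((i + 1 : Fin n) : ℕ) = if (i : ℕ) + 1 = n then 0 else (i : ℕ) + 1 := by
  have hi := i.2
  have h1 : ((1 : Fin n) : ℕ) = 1 := by
    rw [Fin.val_one', Nat.mod_eq_of_lt hn]
  rw [Fin.val_add, h1]
  split_ifs with h
  · rw [h, Nat.mod_self]
  · exact Nat.mod_eq_of_lt (by omega)

theorem fin_succ_eq_zero (i : Fin n) : i + 1 = 0 ↔ (i : ℕ) + 1 = n := by
  rw [← Fin.val_eq_zero_iff, fin_succ_val Nat.AtLeastTwo.prop]
  split_ifs with h <;> simp [h]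

theorem lt_of_succ_eq_zero {i j : Fin n} (h : j + 1 = 0) (hij : i ≠ j) : i < j := by
  rw [fin_succ_eq_zero] at h
  have := i.2
  rw [Fin.lt_def]
  have : (i : ℕ) ≠ j := fun e => hij (Fin.ext e)
  omega

theorem fin_succ_lt {i j : Fin n} (h : i < j) (hj : j + 1 ≠ 0) : i + 1 < j + 1 := by
  rw [Ne, fin_succ_eq_zero] at hj
  rw [Fin.lt_def] at h ⊢
  have := j.2
  rw [fin_succ_val Nat.AtLeastTwo.prop, fin_succ_val Nat.AtLeastTwo.prop, if_neg hj,
    if_neg (by omega)]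
  omega

theorem lower_lt {k : GL (Fin n) F} (hk : k ∈ iwahoriPlus n F) {i j : Fin n} (hij : j < i) :
    valuation F (k i j) < 1 := by
  have := ((mem_iwahoriPlus k).1 hk).2 i j hij.le
  rwa [Matrix.one_apply_ne hij.ne', sub_zero] at this

theorem conj_gMat_mem {ϖ : Fˣ} (hϖ : IsUniformizer ϖ) {k : GL (Fin n) F}
    (hk : k ∈ iwahoriPlus n F) : gMat n ϖ * k * (gMat n ϖ)⁻¹ ∈ iwahoriPlus n F := by
  have hlow : ∀ i j : Fin n, j < i → valuation F (k i j) < 1 := fun i j => lower_lt hk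
  rw [mem_iwahoriPlus] at hk ⊢
  obtain ⟨h1, h2⟩ := hk
  have hϖ1 : valuation F (ϖ : F) < 1 := (hϖ _).2 le_rfl
  have hϖ0 : 0 < valuation F (ϖ : F) := by simp [zero_lt_iff]
  have hdiag : ∀ i : Fin n, weight ϖ i * k i i / weight ϖ i = k i i := fun i =>
    mul_div_cancel_left₀ _ (weight_ne_zero ϖ i)
  have hlow' : ∀ i j : Fin n, j < i →
      valuation F (weight ϖ (i + 1) * k (i + 1) (j + 1) / weight ϖ (j + 1)) < 1 := by
    intro i j hij
    have hj : j + 1 ≠ 0 := fun h => (lt_of_succ_eq_zero h hij.ne').not_gt hij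
    by_cases hi : i + 1 = 0
    · simp only [weight, hi, hj, if_true, if_false, div_one, map_mul]
      exact mul_lt_one_of_lt_of_le hϖ1 (h1 _ _)
    · simp only [weight, hi, hj, if_false, div_one, one_mul]
      exact hlow _ _ (fin_succ_lt hij hi)
  refine ⟨fun i j => ?_, fun i j hij => ?_⟩
  · rw [conj_gMat_apply]
    rcases lt_trichotomy i j with hij | rfl | hij
    · have hi : i + 1 ≠ 0 := fun h => (lt_of_succ_eq_zero h hij.ne').not_gt hij
      by_cases hj : j + 1 = 0
      · simp only [weight, hi, hj, if_true, if_false, one_mul, map_div₀]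
        rw [div_le_one₀ hϖ0, ← hϖ]
        exact hlow _ _ (Fin.pos_iff_ne_zero.2 hi)
      · simp only [weight, hi, hj, if_false, div_one, one_mul]
        exact h1 _ _
    · rw [hdiag]; exact h1 _ _
    · exact (hlow' i j hij).le
  · rw [conj_gMat_apply]
    rcases hij.lt_or_eq with hij | rfl
    · rw [Matrix.one_apply_ne hij.ne', sub_zero]
      exact hlow' i j hij
    · rw [hdiag, Matrix.one_apply_eq]
      simpa using h2 (j + 1) (j + 1) le_rfl

theorem inv_conj_gMat_mem {ϖ : Fˣ} (hϖ : IsUniformizer ϖ) {k : GL (Fin n) F}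
    (hk : k ∈ iwahoriPlus n F) : (gMat n ϖ)⁻¹ * k * gMat n ϖ ∈ iwahoriPlus n F := by
  have hpow : ∀ m : ℕ, gMat n ϖ ^ m * k * (gMat n ϖ ^ m)⁻¹ ∈ iwahoriPlus n F := by
    intro m
    induction m with
    | zero => simpa using hk
    | succ m ih =>
      have := conj_gMat_mem hϖ ih
      rw [pow_succ']
      convert this using 1
      group
  have h := hpow (n - 1)
  have hn : gMat n ϖ ^ (n - 1) = zMat n ϖ * (gMat n ϖ)⁻¹ := by
    rw [eq_mul_inv_iff_mul_eq, ← pow_succ, Nat.sub_add_cancel (NeZero.one_le), gMat_pow_n]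
  rw [hn] at h
  convert h using 1
  have := zMat_comm ϖ ((gMat n ϖ)⁻¹ * k * gMat n ϖ)
  calc _ = (gMat n ϖ)⁻¹ * k * gMat n ϖ * zMat n ϖ * (zMat n ϖ)⁻¹ := by group
    _ = _ := by rw [← this]; group

theorem zpow_conj_gMat {ϖ : Fˣ} (hϖ : IsUniformizer ϖ) (j : ℤ) {k : GL (Fin n) F}
    (hk : k ∈ iwahoriPlus n F) : gMat n ϖ ^ j * k * (gMat n ϖ ^ j)⁻¹ ∈ iwahoriPlus n F ∧
      affineSum ϖ (gMat n ϖ ^ j * k * (gMat n ϖ ^ j)⁻¹) = affineSum ϖ k := by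
  induction j using Int.induction_on with
  | zero => simpa using hk
  | succ m ih =>
    have e : gMat n ϖ ^ ((m : ℤ) + 1) * k * (gMat n ϖ ^ ((m : ℤ) + 1))⁻¹ =
        gMat n ϖ * (gMat n ϖ ^ (m : ℤ) * k * (gMat n ϖ ^ (m : ℤ))⁻¹) * (gMat n ϖ)⁻¹ := by
      rw [add_comm, zpow_add, zpow_one]; group
    rw [e]
    exact ⟨conj_gMat_mem hϖ ih.1, (affineSum_conj _ _).trans ih.2⟩
  | pred m ih =>
    have e : gMat n ϖ ^ (-(m : ℤ) - 1) * k * (gMat n ϖ ^ (-(m : ℤ) - 1))⁻¹ =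
        (gMat n ϖ)⁻¹ * (gMat n ϖ ^ (-(m : ℤ)) * k * (gMat n ϖ ^ (-(m : ℤ)))⁻¹) * gMat n ϖ := by
      rw [sub_eq_add_neg, add_comm, zpow_add, zpow_neg_one]; group
    rw [e]
    refine ⟨inv_conj_gMat_mem hϖ ih.1, Eq.trans ?_ ih.2⟩
    rw [← affineSum_conj]
    congr 1
    group

theorem mul_lt_one_of_le_of_lt' {a b : ValueGroupWithZero F} (ha : a ≤ 1) (hb : b < 1) :
    a * b < 1 := by
  rw [mul_comm]; exact mul_lt_one_of_lt_of_le hb ha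

theorem succ_ne_self (i : Fin n) : i + 1 ≠ i := by
  intro h
  have := congrArg Fin.val h
  rw [fin_succ_val Nat.AtLeastTwo.prop] at this
  have h2 : 2 ≤ n := Nat.AtLeastTwo.prop
  split_ifs at this <;> omega

theorem entry_div_le {ϖ : Fˣ} (hϖ : IsUniformizer ϖ) {k : GL (Fin n) F}
    (hk : k ∈ iwahoriPlus n F) {l i : Fin n} (hl : l ≠ i) :
    valuation F (k l i / weight ϖ i) ≤ 1 := by
  by_cases hi : i = 0
  · have hϖ0 : 0 < valuation F (ϖ : F) := by simp [zero_lt_iff]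
    subst hi
    simp only [weight, if_true, map_div₀]
    rw [div_le_one₀ hϖ0, ← hϖ]
    exact lower_lt hk (Fin.pos_iff_ne_zero.2 hl)
  · simp only [weight, hi, if_false, div_one]
    exact ((mem_iwahoriPlus k).1 hk).1 _ _

/-- The character `k ↦ ψ(r_1 + ⋯ + r_n)` of `I⁺` is multiplicative. -/
theorem psi_affineSum_mul {ψ : AddChar F ℂ} (hψ : IsLevelOne ψ) {ϖ : Fˣ} (hϖ : IsUniformizer ϖ)
    {k k' : GL (Fin n) F} (hk : k ∈ iwahoriPlus n F) (hk' : k' ∈ iwahoriPlus n F) :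
    ψ (affineSum ϖ (k * k')) = ψ (affineSum ϖ k) * ψ (affineSum ϖ k') := by
  have hd : valuation F (affineSum ϖ (k * k') - (affineSum ϖ k + affineSum ϖ k')) < 1 := by
    unfold affineSum
    rw [← Finset.sum_add_distrib, ← Finset.sum_sub_distrib]
    apply Valuation.map_sum_lt _ one_ne_zero
    intro i _
    have hw := weight_ne_zero ϖ (i + 1)
    have e : (k * k' : GL (Fin n) F) i (i + 1) / weight ϖ (i + 1) -
        (k i (i + 1) / weight ϖ (i + 1) + k' i (i + 1) / weight ϖ (i + 1)) =
        ∑ l : Fin n, (k i l * (k' l (i + 1) / weight ϖ (i + 1)) -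
          ((if l = i + 1 then k i (i + 1) / weight ϖ (i + 1) else 0) +
            if l = i then k' i (i + 1) / weight ϖ (i + 1) else 0)) := by
      rw [Finset.sum_sub_distrib, Finset.sum_add_distrib]
      congr 1
      · change ((k : Matrix (Fin n) (Fin n) F) * (k' : Matrix (Fin n) (Fin n) F)) i (i + 1) / _ = _
        rw [Matrix.mul_apply, Finset.sum_div]
        exact Finset.sum_congr rfl fun l _ => mul_div_assoc _ _ _
      · simp
    rw [e]
    apply Valuation.map_sum_lt _ one_ne_zero
    intro l _
    have hne := succ_ne_self i
    by_cases h1 : l = i + 1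
    · subst h1
      rw [if_pos rfl, if_neg hne, add_zero]
      have e2 : k i (i + 1) * (k' (i + 1) (i + 1) / weight ϖ (i + 1)) -
          k i (i + 1) / weight ϖ (i + 1) =
          (k i (i + 1) / weight ϖ (i + 1)) * (k' (i + 1) (i + 1) - 1) := by ring
      rw [e2, map_mul]
      have := ((mem_iwahoriPlus k').1 hk').2 (i + 1) (i + 1) le_rfl
      rw [Matrix.one_apply_eq] at this
      exact mul_lt_one_of_le_of_lt' (entry_div_le hϖ hk hne.symm) this
    · rw [if_neg h1, zero_add]
      by_cases h2 : l = i
      · subst h2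
        rw [if_pos rfl]
        have e2 : k l l * (k' l (l + 1) / weight ϖ (l + 1)) - k' l (l + 1) / weight ϖ (l + 1) =
          (k l l - 1) * (k' l (l + 1) / weight ϖ (l + 1)) := by ring
        rw [e2, map_mul]
        have := ((mem_iwahoriPlus k).1 hk).2 l l le_rfl
        rw [Matrix.one_apply_eq] at this
        exact mul_lt_one_of_lt_of_le this (entry_div_le hϖ hk' hne.symm)
      · rw [if_neg h2, sub_zero, map_mul]
        by_cases h3 : l < i
        · exact mul_lt_one_of_lt_of_le (lower_lt hk h3) (entry_div_le hϖ hk' h1)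
        · have h3 : i < l := lt_of_le_of_ne (not_lt.1 h3) (Ne.symm h2)
          have h4 : i + 1 ≠ 0 := fun h => (lt_of_succ_eq_zero h h2).not_gt h3
          have h5 : i + 1 < l := by
            refine lt_of_le_of_ne ?_ (Ne.symm h1)
            rw [Fin.lt_def] at h3
            rw [Fin.le_def, fin_succ_val Nat.AtLeastTwo.prop]
            split_ifs <;> omega
          refine mul_lt_one_of_le_of_lt' (((mem_iwahoriPlus k).1 hk).1 _ _) ?_
          simp only [weight, h4, if_false, div_one]
          exact lower_lt hk' h5
  have := hψ.1 _ hd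
  rw [← AddChar.map_add_eq_mul]
  rw [← sub_add_cancel (affineSum ϖ (k * k')) (affineSum ϖ k + affineSum ϖ k'),
    AddChar.map_add_eq_mul, this, one_mul]

variable (F) in
/-- The parameters of a simple supercuspidal representation (once `ψ` is fixed):
a character `ω` of `Z = Fˣ` trivial on `1 + 𝔭`, a uniformizer `ϖ`, and an `n`-th root `ζ` of
`ω(ϖ)`. -/
structure Datum (n : ℕ) where
  ω : Fˣ →* ℂˣ
  ω_tame : ∀ x : Fˣ, valuation F ((x : F) - 1) < 1 → ω x = 1
  ϖ : Fˣ
  uniformizer : IsUniformizer ϖ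
  ζ : ℂˣ
  ζ_pow : ζ ^ n = ω ϖ

theorem val_eq_one_of_sub {x : F} (hx : valuation F (x - 1) < 1) : valuation F x = 1 := by
  have := (valuation F).map_one_add_of_lt hx
  rwa [add_sub_cancel] at this

open scoped Fin.CommRing in
/-- Compatibility of the formulas for `χ_ζ` and `ψ_U` on `U ∩ ⟨g_ϖ⟩ Z I⁺`. -/
theorem psiU_eq_of_mem {ψ : AddChar F ℂ} (hψ : IsLevelOne ψ) (D : Datum F n) {j : ℤ} {z : Fˣ}
    {k : GL (Fin n) F} (hk : k ∈ iwahoriPlus n F)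
    (hu : gMat n D.ϖ ^ j * zMat n z * k ∈ upperUnipotent n F) :
    ((D.ζ ^ j * D.ω z : ℂˣ) : ℂ) * ψ (affineSum D.ϖ k) =
      psiU ψ (gMat n D.ϖ ^ j * zMat n z * k) := by
  obtain ⟨r, q, hr, rfl⟩ : ∃ (r : ℕ) (q : ℤ), r < n ∧ j = n * q + r := by
    have hn : (0 : ℤ) < n := by exact_mod_cast NeZero.pos n
    refine ⟨(j % n).toNat, j / n, ?_, ?_⟩
    · have := Int.emod_lt_of_pos j hn
      omega
    · rw [Int.toNat_of_nonneg (Int.emod_nonneg _ hn.ne')]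
      exact (Int.mul_ediv_add_emod j n).symm
  set c : Fˣ := D.ϖ ^ q * z with hc
  have hx : gMat n D.ϖ ^ ((n : ℤ) * q + r) * zMat n z * k =
      gMat n D.ϖ ^ r * (zMat n c * k) := by
    rw [zpow_add, zpow_mul, zpow_natCast, zpow_natCast, gMat_pow_n, hc]
    have h1 : zMat n D.ϖ ^ q = zMat n (D.ϖ ^ q) := (map_zpow _ _ _).symm
    have h2 : zMat n (D.ϖ ^ q * z) = zMat n (D.ϖ ^ q) * zMat n z := map_mul _ _ _
    rw [h1, h2, zMat_comm]
    have h3 := zMat_comm (D.ϖ ^ q) (zMat n z)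
    rw [mul_assoc (gMat n D.ϖ ^ r), h3, ← h3, mul_assoc]
  rw [hx] at hu ⊢
  have hdiag : ∀ i, valuation F (k i i - 1) < 1 := by
    intro i
    have := ((mem_iwahoriPlus k).1 hk).2 i i le_rfl
    rwa [Matrix.one_apply_eq] at this
  have hk1 : ∀ i, valuation F (k i i) = 1 := fun i => val_eq_one_of_sub (hdiag i)
  have hk0 : ∀ i, k i i ≠ 0 := by
    intro i h
    have := hk1 i
    simp [h] at this
  have hr0 : r = 0 := by
    by_contra hr0
    have hcast : ((r : ℕ) : Fin n) ≠ 0 := by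
      intro h
      have := congrArg Fin.val h
      rw [Fin.val_natCast, Nat.mod_eq_of_lt hr] at this
      exact hr0 (by simpa using this)
    have hi : (-1 : Fin n) + 1 = 0 := neg_add_cancel 1
    have hl : (-1 : Fin n) + (r : Fin n) ≠ -1 := by simpa using hcast
    have hlt := lt_of_succ_eq_zero hi hl
    have h0 := hu _ _ hlt.le
    rw [Matrix.one_apply_ne hlt.ne', gMat_pow_mul_apply, zMat_mul_apply] at h0
    refine mul_ne_zero ?_ (mul_ne_zero c.ne_zero (hk0 _)) h0
    exact Finset.prod_ne_zero_iff.2 fun t _ => weight_ne_zero _ _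
  subst hr0
  rw [pow_zero, one_mul] at hu ⊢
  have hent : ∀ i j, j ≤ i → (c : F) * k i j = (1 : Matrix (Fin n) (Fin n) F) i j := by
    intro i j hij
    rw [← zMat_mul_apply]
    exact hu i j hij
  have hc1 : valuation F ((c : F) - 1) < 1 := by
    have h := hent 0 0 le_rfl
    rw [Matrix.one_apply_eq] at h
    have hv : valuation F (c : F) = 1 := by
      have := congrArg (valuation F) h
      rwa [map_mul, hk1, mul_one, map_one] at this
    have e : (c : F) - 1 = -(c * (k 0 0 - 1)) := by rw [mul_sub, h]; ring
    rw [e, Valuation.map_neg, map_mul, hv, one_mul]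
    exact hdiag 0
  have hω : D.ζ ^ ((n : ℤ) * q + (0 : ℕ)) * D.ω z = 1 := by
    rw [Nat.cast_zero, add_zero, zpow_mul, zpow_natCast, D.ζ_pow, ← map_zpow, ← map_mul, ← hc]
    exact D.ω_tame c hc1
  rw [hω, Units.val_one, one_mul]
  unfold psiU
  have hd : valuation F (affineSum D.ϖ k -
      ∑ i : Fin n, if i + 1 = 0 then 0 else (zMat n c * k : GL (Fin n) F) i (i + 1)) < 1 := by
    unfold affineSum
    rw [← Finset.sum_sub_distrib]
    apply Valuation.map_sum_lt _ one_ne_zero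
    intro i _
    by_cases hi : i + 1 = 0
    · have hne := succ_ne_self i
      have h0 := hent i (i + 1) (by rw [hi]; exact Fin.zero_le _)
      rw [Matrix.one_apply_ne hne.symm] at h0
      have : k i (i + 1) = 0 := by simpa using h0
      rw [if_pos hi, this]
      simp
    · rw [if_neg hi, zMat_mul_apply]
      have e : k i (i + 1) / weight D.ϖ (i + 1) - c * k i (i + 1) =
          -(k i (i + 1) * (c - 1)) := by
        simp only [weight, hi, if_false]; ring
      rw [e, Valuation.map_neg, map_mul]
      exact mul_lt_one_of_le_of_lt' (((mem_iwahoriPlus k).1 hk).1 _ _) hc1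
  rw [← sub_add_cancel (affineSum D.ϖ k)
    (∑ i : Fin n, if i + 1 = 0 then 0 else (zMat n c * k : GL (Fin n) F) i (i + 1)),
    AddChar.map_add_eq_mul, hψ.1 _ hd, one_mul]

theorem psiU_one (ψ : AddChar F ℂ) : psiU ψ (1 : GL (Fin n) F) = 1 := by
  unfold psiU
  rw [Finset.sum_eq_zero, AddChar.map_zero_eq_one]
  intro i _
  split_ifs
  · rfl
  · exact Matrix.one_apply_ne (succ_ne_self i).symm

theorem group_mul_form (g : GL (Fin n) F) (j j' : ℤ) (z z' : Fˣ) (k k' : GL (Fin n) F) :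
    g ^ j * zMat n z * k * (g ^ j' * zMat n z' * k') =
      g ^ (j + j') * zMat n (z * z') * (g ^ (-j') * k * (g ^ (-j'))⁻¹ * k') := by
  have h1 := zMat_comm z' (k * g ^ j')
  have h2 := zMat_comm (z * z') (g ^ j')
  have h3 : zMat n (z * z') = zMat n z * zMat n z' := map_mul _ _ _
  calc _ = g ^ j * zMat n z * ((k * g ^ j') * zMat n z') * k' := by group
    _ = g ^ j * zMat n (z * z') * k * g ^ j' * k' := by rw [← h1, h3]; group
    _ = g ^ j * (g ^ j' * zMat n (z * z')) * (g ^ j')⁻¹ * k * g ^ j' * k' := by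
      rw [← h2]; group
    _ = _ := by group

theorem group_inv_form (g : GL (Fin n) F) (j : ℤ) (z : Fˣ) (k : GL (Fin n) F) :
    (g ^ j * zMat n z * k)⁻¹ = g ^ (-j) * zMat n z⁻¹ * (g ^ j * k⁻¹ * (g ^ j)⁻¹) := by
  have h1 := zMat_comm z⁻¹ (g ^ j * k⁻¹ * (g ^ j)⁻¹)
  have h3 : zMat n z⁻¹ = (zMat n z)⁻¹ := map_inv _ _
  have h2 := zMat_comm z (g ^ j)
  calc _ = k⁻¹ * (g ^ j * zMat n z)⁻¹ := by group
    _ = g ^ (-j) * (g ^ j * k⁻¹ * (g ^ j)⁻¹ * zMat n z⁻¹) := by rw [← h2, h3]; group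
    _ = _ := by rw [← h1]; group

/-- The group `H' = ⟨g_ϖ⟩ Z I⁺`. -/
def Datum.group (D : Datum F n) : Subgroup (GL (Fin n) F) where
  carrier := {x | ∃ (j : ℤ) (z : Fˣ), ∃ k ∈ iwahoriPlus n F, x = gMat n D.ϖ ^ j * zMat n z * k}
  one_mem' := ⟨0, 1, 1, one_mem _, by simp⟩
  mul_mem' := by
    rintro _ _ ⟨j, z, k, hk, rfl⟩ ⟨j', z', k', hk', rfl⟩
    exact ⟨j + j', z * z', _, mul_mem (zpow_conj_gMat D.uniformizer (-j') hk).1 hk',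
      group_mul_form _ _ _ _ _ _ _⟩
  inv_mem' := by
    rintro _ ⟨j, z, k, hk, rfl⟩
    exact ⟨-j, z⁻¹, _, (zpow_conj_gMat D.uniformizer j (inv_mem hk)).1, group_inv_form _ _ _ _⟩

theorem char_wellDefined {ψ : AddChar F ℂ} (hψ : IsLevelOne ψ) (D : Datum F n) {j j' : ℤ}
    {z z' : Fˣ} {k k' : GL (Fin n) F} (hk : k ∈ iwahoriPlus n F) (hk' : k' ∈ iwahoriPlus n F)
    (h : gMat n D.ϖ ^ j * zMat n z * k = gMat n D.ϖ ^ j' * zMat n z' * k') :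
    ((D.ζ ^ j * D.ω z : ℂˣ) : ℂ) * ψ (affineSum D.ϖ k) =
      ((D.ζ ^ j' * D.ω z' : ℂˣ) : ℂ) * ψ (affineSum D.ϖ k') := by
  have h1 : gMat n D.ϖ ^ (j - j') * zMat n (z * z'⁻¹) * (k * k'⁻¹) = 1 := by
    have h3 : zMat n (z * z'⁻¹) = (zMat n z')⁻¹ * zMat n z := by
      rw [mul_comm]
      exact (map_mul _ _ _).trans (congrArg (· * zMat n z) (map_inv _ _))
    have h4 : zMat n z'⁻¹ = (zMat n z')⁻¹ := map_inv _ _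
    have h5 := zMat_comm z'⁻¹ (gMat n D.ϖ ^ j)
    rw [h4] at h5
    calc _ = gMat n D.ϖ ^ (-j') * (gMat n D.ϖ ^ j * (zMat n z')⁻¹) * zMat n z * k * k'⁻¹ := by
          rw [h3]; group
      _ = gMat n D.ϖ ^ (-j') * (zMat n z')⁻¹ * (gMat n D.ϖ ^ j * zMat n z * k) * k'⁻¹ := by
          rw [← h5]; group
      _ = gMat n D.ϖ ^ (-j') * ((zMat n z')⁻¹ * gMat n D.ϖ ^ j') * zMat n z' := by
          rw [h]; group
      _ = 1 := by
          have h6 := zMat_comm z'⁻¹ (gMat n D.ϖ ^ j')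
          rw [h4] at h6
          rw [h6]; group
  have hm : k * k'⁻¹ ∈ iwahoriPlus n F := mul_mem hk (inv_mem hk')
  have h2 := psiU_eq_of_mem hψ D hm (h1 ▸ one_mem _)
  rw [h1, psiU_one] at h2
  have h3 := psi_affineSum_mul hψ D.uniformizer hm hk'
  rw [inv_mul_cancel_right] at h3
  have h4 : D.ζ ^ j * D.ω z = (D.ζ ^ (j - j') * D.ω (z * z'⁻¹)) * (D.ζ ^ j' * D.ω z') := by
    rw [zpow_sub, map_mul, map_inv, mul_mul_mul_comm]
    simp
  rw [h3, h4, Units.val_mul]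
  calc _ = (((D.ζ ^ (j - j') * D.ω (z * z'⁻¹) : ℂˣ) : ℂ) * ψ (affineSum D.ϖ (k * k'⁻¹))) *
        (((D.ζ ^ j' * D.ω z' : ℂˣ) : ℂ) * ψ (affineSum D.ϖ k')) := by ring
    _ = _ := by rw [h2, one_mul]

/-- The formula for `χ_ζ` evaluated on a chosen decomposition of `x`. -/
def Datum.charVal (ψ : AddChar F ℂ) (D : Datum F n) (x : D.group) : ℂ :=
  ((D.ζ ^ x.2.choose * D.ω x.2.choose_spec.choose : ℂˣ) : ℂ) *
    ψ (affineSum D.ϖ x.2.choose_spec.choose_spec.choose)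

/-- The value of `χ_ζ` does not depend on the decomposition:
`χ_ζ(g_ϖ^j z k) = ζ^j ω(z) ψ(r_1 + ⋯ + r_n)`. -/
theorem Datum.charVal_eq {ψ : AddChar F ℂ} (hψ : IsLevelOne ψ) (D : Datum F n) (x : D.group)
    {j : ℤ} {z : Fˣ} {k : GL (Fin n) F} (hk : k ∈ iwahoriPlus n F)
    (hx : (x : GL (Fin n) F) = gMat n D.ϖ ^ j * zMat n z * k) :
    D.charVal ψ x = ((D.ζ ^ j * D.ω z : ℂˣ) : ℂ) * ψ (affineSum D.ϖ k) := by
  have h := x.2.choose_spec.choose_spec.choose_spec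
  exact char_wellDefined hψ D h.1 hk (h.2.symm.trans hx)

/-- The character `χ_ζ` of `H' = ⟨g_ϖ⟩ Z I⁺`. -/
def Datum.char {ψ : AddChar F ℂ} (hψ : IsLevelOne ψ) (D : Datum F n) : D.group →* ℂ where
  toFun := D.charVal ψ
  map_one' := by
    have := psiU_one (n := n) ψ
    rw [D.charVal_eq hψ 1 (j := 0) (z := 1) (one_mem _) (by simp)]
    have h0 : affineSum D.ϖ (1 : GL (Fin n) F) = 0 := by
      unfold affineSum
      apply Finset.sum_eq_zero
      intro i _
      have : (1 : GL (Fin n) F) i (i + 1) = 0 := Matrix.one_apply_ne (succ_ne_self i).symm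
      rw [this, zero_div]
    rw [h0]
    simp
  map_mul' := by
    intro x y
    obtain ⟨j, z, k, hk, hx⟩ := x.2
    obtain ⟨j', z', k', hk', hy⟩ := y.2
    have hc := zpow_conj_gMat D.uniformizer (-j') hk
    have hxy : ((x * y : D.group) : GL (Fin n) F) = gMat n D.ϖ ^ (j + j') * zMat n (z * z') *
        (gMat n D.ϖ ^ (-j') * k * (gMat n D.ϖ ^ (-j'))⁻¹ * k') := by
      rw [Subgroup.coe_mul, hx, hy, group_mul_form]
    rw [D.charVal_eq hψ x hk hx, D.charVal_eq hψ y hk' hy,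
      D.charVal_eq hψ (x * y) (mul_mem hc.1 hk') hxy,
      psi_affineSum_mul hψ D.uniformizer hc.1 hk', hc.2, zpow_add, map_mul]
    push_cast
    ring

theorem psiU_mul (ψ : AddChar F ℂ) {u u' : GL (Fin n) F} (hu : u ∈ upperUnipotent n F)
    (hu' : u' ∈ upperUnipotent n F) : psiU ψ (u * u') = psiU ψ u * psiU ψ u' := by
  unfold psiU
  rw [← AddChar.map_add_eq_mul, ← Finset.sum_add_distrib]
  congr 1
  apply Finset.sum_congr rfl
  intro i _
  by_cases hi : i + 1 = 0
  · simp [hi]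
  · simp only [if_neg hi]
    change ((u : Matrix (Fin n) (Fin n) F) * (u' : Matrix (Fin n) (Fin n) F)) i (i + 1) = _
    have hne := succ_ne_self i
    rw [Matrix.mul_apply, ← Finset.sum_subset (Finset.subset_univ {i, i + 1}),
      Finset.sum_pair hne.symm, hu i i le_rfl, hu' _ _ (le_refl (i + 1)), Matrix.one_apply_eq,
      Matrix.one_apply_eq, one_mul, mul_one, add_comm]
    intro l _ hl
    simp only [Finset.mem_insert, Finset.mem_singleton, not_or] at hl
    rcases lt_or_gt_of_ne hl.1 with h | h
    · rw [hu i l h.le, Matrix.one_apply_ne h.ne', zero_mul]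
    · have h5 : i + 1 ≤ l := by
        rw [Fin.lt_def] at h
        rw [Fin.le_def, fin_succ_val Nat.AtLeastTwo.prop]
        split_ifs <;> omega
      rw [hu' l (i + 1) h5, Matrix.one_apply_ne hl.2, mul_zero]

open Classical in
/-- The Whittaker function `W_{ϖ,ζ}`: it is `ψ_U(u) χ_ζ(h)` at `u h` for `u ∈ U`, `h ∈ H'`, and
`0` off `U H'`. -/
def Datum.whittaker {ψ : AddChar F ℂ} (hψ : IsLevelOne ψ) (D : Datum F n) (g : GL (Fin n) F) : ℂ :=
  if hg : ∃ (u : upperUnipotent n F) (h : D.group), g = u * h then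
    psiU ψ (hg.choose : GL (Fin n) F) * D.char hψ hg.choose_spec.choose
  else 0

/-- The value of `W_{ϖ,ζ}` does not depend on the decomposition. -/
theorem Datum.whittaker_mul {ψ : AddChar F ℂ} (hψ : IsLevelOne ψ) (D : Datum F n)
    (u : upperUnipotent n F) (h : D.group) :
    D.whittaker hψ (u * h) = psiU ψ (u : GL (Fin n) F) * D.char hψ h := by
  have hg : ∃ (u' : upperUnipotent n F) (h' : D.group),
      (u * h : GL (Fin n) F) = u' * h' := ⟨u, h, rfl⟩
  rw [Datum.whittaker, dif_pos hg]
  suffices key : ∀ (u' : upperUnipotent n F) (h' : D.group), (u * h : GL (Fin n) F) = u' * h' →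
      psiU ψ (u' : GL (Fin n) F) * D.char hψ h' = psiU ψ (u : GL (Fin n) F) * D.char hψ h from
    key _ _ hg.choose_spec.choose_spec
  intro u' h' hs
  have hm : (h' * h⁻¹ : GL (Fin n) F) = u'⁻¹ * u := by
    rw [InvMemClass.coe_inv, InvMemClass.coe_inv, mul_inv_eq_iff_eq_mul, mul_assoc, hs,
      inv_mul_cancel_left]
  have hmem : (u'⁻¹ * u : GL (Fin n) F) ∈ upperUnipotent n F := mul_mem (inv_mem u'.2) u.2
  have hχ : D.char hψ (h' * h⁻¹) = psiU ψ (u'⁻¹ * u : GL (Fin n) F) := by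
    obtain ⟨j, z, k, hk, hx⟩ := (h' * h⁻¹).2
    have hx' : (u'⁻¹ * u : GL (Fin n) F) = gMat n D.ϖ ^ j * zMat n z * k := hm.symm.trans hx
    rw [hx'] at hmem ⊢
    exact (D.charVal_eq hψ _ hk hx).trans (psiU_eq_of_mem hψ D hk hmem)
  have h1 : D.char hψ h' = D.char hψ (h' * h⁻¹) * D.char hψ h := by
    rw [← map_mul, inv_mul_cancel_right]
  rw [h1, hχ, ← mul_assoc, ← psiU_mul ψ u'.2 hmem, InvMemClass.coe_inv,
    mul_inv_cancel_left]

end Affine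

/-! ## Special pairs of Whittaker functions -/

/-- `π` preserves some positive definite Hermitian form. -/
def IsUnitarizable {G V : Type*} [Group G] [AddCommGroup V] [Module ℂ V]
    (π : Representation ℂ G V) : Prop :=
  ∃ c : InnerProductSpace.Core ℂ V, ∀ (g : G) (v w : V), c.inner (π g v) (π g w) = c.inner v w

/-- `K` is an open subgroup containing the center `Z` such that `K / Z` is compact. -/
def IsOpenCompactModCenter {G : Type*} [Group G] [TopologicalSpace G] (K : Subgroup G) : Prop :=
  IsOpen (K : Set G) ∧ Subgroup.center G ≤ K ∧
    IsCompact ((QuotientGroup.mk : G → G ⧸ Subgroup.center G) '' (K : Set G))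

section Special

variable {F : Type*} [Field F] [ValuativeRel F] {n : ℕ} [n.AtLeastTwo]
variable {V V' : Type*} [AddCommGroup V] [Module ℂ V] [AddCommGroup V'] [Module ℂ V']

/-- The center acts through the character `ω`. -/
def HasCentralChar (π : Representation ℂ (GL (Fin n) F) V) (ω : Fˣ →* ℂˣ) : Prop :=
  ∀ (z : Fˣ) (v : V), π (zMat n z) v = (ω z : ℂ) • v

/-- `W` lies in the Whittaker model of `π`: it is `g ↦ l (π g v)` for a vector `v` and a nonzero
`(U, ψ_U)`-equivariant functional `l`. -/
def IsWhittakerFunction (ψ : AddChar F ℂ) (π : Representation ℂ (GL (Fin n) F) V)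
    (W : GL (Fin n) F → ℂ) : Prop :=
  ∃ l : V →ₗ[ℂ] ℂ, l ≠ 0 ∧ (∀ u ∈ upperUnipotent n F, ∀ v, l (π u v) = psiU ψ u * l v) ∧
    ∃ v : V, ∀ g, W g = l (π g v)

/-- `W` is a `K`-special Whittaker function for `π`. -/
structure IsKSpecial [TopologicalSpace F] (ψ : AddChar F ℂ)
    (π : Representation ℂ (GL (Fin n) F) V) (K : Subgroup (GL (Fin n) F))
    (W : GL (Fin n) F → ℂ) : Prop where
  compact_mod_center : IsOpenCompactModCenter K
  whittaker : IsWhittakerFunction ψ π W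
  ne_zero : W ≠ 0
  support_subset : ∀ g, W g ≠ 0 → ∃ u ∈ upperUnipotent n F, ∃ k ∈ K, g = u * k
  conj_symm : ∀ k ∈ K, W k⁻¹ = (starRingEnd ℂ) (W k)

/-- `(W₁, W₂)` is a special pair of Whittaker functions for `(π₁, π₂)`. -/
def IsSpecialPair [TopologicalSpace F] (ψ : AddChar F ℂ) (π₁ : Representation ℂ (GL (Fin n) F) V)
    (π₂ : Representation ℂ (GL (Fin n) F) V') (W₁ W₂ : GL (Fin n) F → ℂ) : Prop :=
  ∃ K : Subgroup (GL (Fin n) F), IsKSpecial ψ π₁ K W₁ ∧ IsKSpecial ψ π₂ K W₂ ∧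
    ∀ p ∈ mirabolic n F, W₁ p = W₂ p

/-- The group `⟨g_{ϖ₁}, g_{ϖ₂}⟩ Z I⁺`. -/
def jointGroup (n : ℕ) [n.AtLeastTwo] (ϖ₁ ϖ₂ : Fˣ) : Subgroup (GL (Fin n) F) :=
  Subgroup.closure {gMat n ϖ₁, gMat n ϖ₂} ⊔ Subgroup.center (GL (Fin n) F) ⊔ iwahoriPlus n F

variable [TopologicalSpace F] [IsNonarchimedeanLocalField F]

/-- The simple supercuspidal representation `π_{ϖ,ζ} = ind_{H'}^G χ_ζ`. -/
def Datum.rep {ψ : AddChar F ℂ} (hψ : IsLevelOne ψ) (D : Datum F n) :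
    Representation ℂ (GL (Fin n) F) (compactInd D.group (D.char hψ)) :=
  compactIndRep D.group (D.char hψ)

/-- `π` is isomorphic to one of the representations `π_{ϖ,ζ}`. -/
def IsSimpleSupercuspidal {ψ : AddChar F ℂ} (hψ : IsLevelOne ψ)
    (π : Representation ℂ (GL (Fin n) F) V) : Prop :=
  ∃ D : Datum F n, Nonempty (π.Equiv (D.rep hψ))

end Special

end

end SimpleSC

/-! Write H' for `D.group` and χ for its character. Since χ and ψ_U agree on U ∩ H', the averaging
functional f ↦ ∑ ψ_U(u) f(u⁻¹) over U ⧸ (U ∩ H') is well defined on ind χ, and openness of H' makes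
every such sum finite. Applied to the translates of the function that extends χ by zero, it returns
exactly W_{ϖ,ζ}, because at u h only the coset of u contributes (`whittakerFunctional_extendZero`,
`Datum.isWhittakerFunction`).

The group K is controlled through the normalizer ⟨g_ϖ⟩ Z I of the full Iwahori subgroup I. Two
matrices g_ϖ differ by a unit diagonal matrix, so K lies in this normalizer (`jointGroup_le`), and
g_ϖ^n being scalar then gives compactness modulo Z. Moreover U meets the normalizer inside I⁺
(`upperUnipotent_inf_iwahoriNormalizer_le`), so on K the function W is χ extended by zero from H'.
The symmetry W(k⁻¹) = conj W(k) thus reduces to |χ| = 1 (`Datum.norm_char`).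

On P_n nothing depends on ϖ or ζ: P_n ∩ H' lies in I⁺ (`group_inf_mirabolic_le`), and there the
lower left entry vanishes, so χ is ψ_U. This gives W₁ = W₂ on P_n.

Part (b) transports these functions along isomorphisms. An invariant inner product makes the central
character unitary, and the induced model determines ω (`Datum.eq_ω`). -/

namespace SimpleSC

noncomputable section

/-! ## Whittaker functionals on compactly induced representations -/

section Functional

variable {G : Type*} [Group G] [TopologicalSpace G] [IsTopologicalGroup G]
variable {H U : Subgroup G} {χ : H →* ℂ} {θ : U →* ℂ}

open Classical in
/-- The function supported on `H` that extends `χ`. -/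
def extendZero (χ : H →* ℂ) (g : G) : ℂ := if h : g ∈ H then χ ⟨g, h⟩ else 0

theorem extendZero_of_mem {g : G} (h : g ∈ H) : extendZero χ g = χ ⟨g, h⟩ := dif_pos h

theorem extendZero_of_notMem {g : G} (h : g ∉ H) : extendZero χ g = 0 := dif_neg h

/-- Smoothness comes from an open subgroup in the kernel of `χ`; the support is `H` itself, so the
compact set can be `{1}`. -/
theorem extendZero_mem_compactInd {L : Subgroup G} (hL : IsOpen (L : Set G)) (hLH : L ≤ H)
    (hχ : ∀ x : H, (x : G) ∈ L → χ x = 1) : extendZero χ ∈ compactInd H χ := by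
  refine ⟨fun h g => ?_, ⟨L, hL, fun g k hk => ?_⟩, {1}, isCompact_singleton, fun g hg => ?_⟩
  · by_cases hg : g ∈ H
    · rw [extendZero_of_mem hg, extendZero_of_mem (mul_mem h.2 hg), ← map_mul]
      rfl
    · rw [extendZero_of_notMem hg, extendZero_of_notMem, mul_zero]
      rwa [Subgroup.mul_mem_cancel_left _ h.2]
  · by_cases hg : g ∈ H
    · rw [extendZero_of_mem hg, extendZero_of_mem (mul_mem hg (hLH hk)),
        ← mul_one (χ ⟨g, hg⟩), ← hχ ⟨k, hLH hk⟩ hk, ← map_mul]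
      rfl
    · rw [extendZero_of_notMem hg, extendZero_of_notMem]
      rwa [Subgroup.mul_mem_cancel_right _ (hLH hk)]
  · refine ⟨g, ?_, 1, rfl, (mul_one g).symm⟩
    by_contra h
    exact hg (extendZero_of_notMem h)

/-- The integrand `u ↦ θ(u) f(u⁻¹)` of the Whittaker functional. -/
def whittakerTerm (θ : U →* ℂ) (f : G → ℂ) (u : U) : ℂ := θ u * f (u : G)⁻¹

/-- Replacing u by u h with h ∈ U ∩ H brings in the factors θ(h) and χ(h⁻¹), which cancel. The
summand is therefore a function of the coset, and the choice made by `out` is harmless. -/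
theorem whittakerTerm_out (hθ : ∀ (u : U) (h : (u : G) ∈ H), θ u = χ ⟨u, h⟩) {f : G → ℂ}
    (hf : f ∈ compactInd H χ) (u : U) :
    whittakerTerm θ f (u : U ⧸ H.subgroupOf U).out = whittakerTerm θ f u := by
  obtain ⟨h, hh⟩ := QuotientGroup.mk_out_eq_mul (H.subgroupOf U) u
  have hmem : ((h : U) : G) ∈ H := h.2
  have h1 : θ h * χ ⟨((h : U) : G)⁻¹, inv_mem hmem⟩ = 1 := by
    rw [hθ _ hmem, ← map_mul, ← map_one χ]
    congr 1
    ext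
    simp
  have h2 := hf.1 ⟨((h : U) : G)⁻¹, inv_mem hmem⟩ (u : G)⁻¹
  rw [hh, whittakerTerm, map_mul, Subgroup.coe_mul, mul_inv_rev, h2, whittakerTerm]
  calc _ = θ u * (θ h * χ ⟨((h : U) : G)⁻¹, inv_mem hmem⟩) * f (u : G)⁻¹ := by ring
    _ = _ := by rw [h1, mul_one]

/-- If f(u⁻¹) ≠ 0 then u⁻¹ ∈ H C, so u H lies in the image of C⁻¹ in G ⧸ H. That image is finite,
being compact in a discrete space, and U ⧸ (U ∩ H) embeds in G ⧸ H. -/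
theorem finite_support_whittakerTerm (hH : IsOpen (H : Set G)) {f : G → ℂ}
    (hf : f ∈ compactInd H χ) :
    (Function.support fun q : U ⧸ H.subgroupOf U => whittakerTerm θ f q.out).Finite := by
  obtain ⟨-, -, C, hC, hsupp⟩ := hf
  have : DiscreteTopology (G ⧸ H) := QuotientGroup.discreteTopology hH
  have hfin : ((fun c : G => ((c⁻¹ : G) : G ⧸ H)) '' C).Finite :=
    (hC.image (QuotientGroup.continuous_mk.comp continuous_inv)).finite_of_discrete
  refine Set.Finite.of_finite_image (f := fun q : U ⧸ H.subgroupOf U => ((q.out : G) : G ⧸ H))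
    (hfin.subset ?_) ?_
  · rintro _ ⟨q, hq, rfl⟩
    obtain ⟨h, hh, c, hc, e⟩ := hsupp _ (right_ne_zero_of_mul hq)
    refine ⟨c, hc, ?_⟩
    change ((c⁻¹ : G) : G ⧸ H) = ((q.out : G) : G ⧸ H)
    rw [QuotientGroup.eq, inv_inv]
    have : c * (q.out : G) = h⁻¹ := by
      rw [← inv_inv (q.out : G), e]; group
    rw [this]
    exact inv_mem hh
  · intro q _ q' _ h
    have h' := QuotientGroup.eq.1 h
    rw [← q.out_eq', ← q'.out_eq']
    exact QuotientGroup.eq.2 h'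

/-- The functional `f ↦ ∑ θ(u) f(u⁻¹)` on `ind_H^G χ`, the sum being over `U ⧸ (U ∩ H)`. -/
def whittakerFunctional (H : Subgroup G) (χ : H →* ℂ) (θ : U →* ℂ) (hH : IsOpen (H : Set G)) :
    compactInd H χ →ₗ[ℂ] ℂ where
  toFun f := ∑ᶠ q : U ⧸ H.subgroupOf U, whittakerTerm θ f.1 q.out
  map_add' f f' := by
    rw [← finsum_add_distrib (finite_support_whittakerTerm hH f.2)
      (finite_support_whittakerTerm hH f'.2)]
    refine finsum_congr fun q => ?_
    simp [whittakerTerm, mul_add]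
  map_smul' a f := by
    rw [RingHom.id_apply, smul_finsum]
    refine finsum_congr fun q => ?_
    simp [whittakerTerm, mul_left_comm]

/-- Left multiplication by u permutes the cosets, and this substitution in the sum produces the
factor θ(u). -/
theorem whittakerFunctional_equivariant (hH : IsOpen (H : Set G))
    (hθ : ∀ (u : U) (h : (u : G) ∈ H), θ u = χ ⟨u, h⟩) (u : U) (f : compactInd H χ) :
    whittakerFunctional H χ θ hH (compactIndRep H χ u f) =
      θ u * whittakerFunctional H χ θ hH f := by
  change ∑ᶠ q : U ⧸ H.subgroupOf U, whittakerTerm θ (compactIndRep H χ u f).1 q.out =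
    θ u • ∑ᶠ q : U ⧸ H.subgroupOf U, whittakerTerm θ f.1 q.out
  rw [smul_finsum, ← finsum_comp_equiv (MulAction.toPerm u : Equiv.Perm (U ⧸ H.subgroupOf U))]
  refine finsum_congr fun q => ?_
  induction q using QuotientGroup.induction_on with
  | H x =>
    -- The translated coset is represented by u times the chosen representative, so that both sides
    -- involve the same element of U.
    rw [MulAction.toPerm_apply, ← MulAction.Quotient.coe_smul_out]
    rw [whittakerTerm_out hθ (compactIndRep H χ u f).2]
    rw [whittakerTerm, smul_eq_mul u, map_mul, smul_eq_mul, whittakerTerm, mul_assoc]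
    congr 2
    change f.1 _ = _
    simp

/-- The coset of q contributes only if q⁻¹ u h ∈ H, that is, only if it is the coset of u. -/
theorem whittakerFunctional_extendZero (hH : IsOpen (H : Set G))
    (hθ : ∀ (u : U) (h : (u : G) ∈ H), θ u = χ ⟨u, h⟩) (hf : extendZero χ ∈ compactInd H χ)
    (u : U) (h : H) :
    whittakerFunctional H χ θ hH (compactIndRep H χ (u * h) ⟨_, hf⟩) = θ u * χ h := by
  set f := compactIndRep H χ (u * h) ⟨_, hf⟩
  change ∑ᶠ q : U ⧸ H.subgroupOf U, whittakerTerm θ f.1 q.out = _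
  rw [finsum_eq_single _ (u : U ⧸ H.subgroupOf U), whittakerTerm_out hθ f.2, whittakerTerm]
  · change θ u * extendZero χ ((u : G)⁻¹ * (u * h)) = _
    rw [inv_mul_cancel_left, extendZero_of_mem h.2]
  · intro q hq
    have : extendZero χ ((q.out : G)⁻¹ * (u * h)) = 0 := by
      refine extendZero_of_notMem fun hm => hq ?_
      rw [← mul_assoc, Subgroup.mul_mem_cancel_right _ h.2] at hm
      rw [← q.out_eq']
      exact QuotientGroup.eq.2 hm
    exact mul_eq_zero_of_right _ this

theorem whittakerFunctional_extendZero_eq_zero (hH : IsOpen (H : Set G))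
    (hf : extendZero χ ∈ compactInd H χ) {g : G} (hg : ¬ ∃ (u : U) (h : H), g = u * h) :
    whittakerFunctional H χ θ hH (compactIndRep H χ g ⟨_, hf⟩) = 0 := by
  refine finsum_eq_zero_of_forall_eq_zero fun q => ?_
  have : extendZero χ ((q.out : G)⁻¹ * g) = 0 :=
    extendZero_of_notMem fun hm => hg ⟨q.out, ⟨_, hm⟩, by simp⟩
  exact mul_eq_zero_of_right _ this

end Functional

/-! ## The Iwahori subgroup and its normalizer -/

section Diagonal

variable {R : Type*} [CommRing R] {n : ℕ}

/-- The invertible diagonal matrices. -/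
def dMat : (Fin n → Rˣ) →* GL (Fin n) R :=
  (Units.map (Matrix.diagonalRingHom (Fin n) R).toMonoidHom).comp
    (MulEquiv.piUnits (M := fun _ : Fin n => R)).symm.toMonoidHom

theorem coe_dMat (τ : Fin n → Rˣ) :
    (dMat τ : Matrix (Fin n) (Fin n) R) = Matrix.diagonal fun i => (τ i : R) := rfl

theorem dMat_mul_apply (τ : Fin n → Rˣ) (k : GL (Fin n) R) (i j : Fin n) :
    (dMat τ * k : GL (Fin n) R) i j = τ i * k i j := by
  change ((dMat τ : Matrix (Fin n) (Fin n) R) * (k : Matrix (Fin n) (Fin n) R)) i j = _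
  rw [coe_dMat, Matrix.diagonal_mul]

theorem mul_dMat_apply (τ : Fin n → Rˣ) (k : GL (Fin n) R) (i j : Fin n) :
    (k * dMat τ : GL (Fin n) R) i j = k i j * τ j := by
  change ((k : Matrix (Fin n) (Fin n) R) * (dMat τ : Matrix (Fin n) (Fin n) R)) i j = _
  rw [coe_dMat, Matrix.mul_diagonal]

end Diagonal

section Iwahori

variable {F : Type*} [Field F] [ValuativeRel F] {n : ℕ} [n.AtLeastTwo]

theorem gMat_mul_dMat (ϖ : Fˣ) (τ : Fin n → Fˣ) :
    gMat n ϖ * dMat τ = dMat (fun i => τ (i + 1)) * gMat n ϖ := by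
  apply Matrix.GeneralLinearGroup.ext
  intro i j
  rw [dMat_mul_apply, mul_dMat_apply]
  simp only [gMat, Matrix.of_apply]
  split_ifs with h
  · rw [h, mul_comm]
  · simp

/-- Since g_ϖ is monomial, conjugation by it only shifts the diagonal entries cyclically. -/
theorem zpow_conj_dMat (ϖ : Fˣ) (j : ℤ) {τ : Fin n → Fˣ} (hτ : ∀ i, valuation F (τ i : F) = 1) :
    ∃ τ' : Fin n → Fˣ, (∀ i, valuation F (τ' i : F) = 1) ∧
      gMat n ϖ ^ j * dMat τ * (gMat n ϖ ^ j)⁻¹ = dMat τ' := by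
  induction j using Int.induction_on with
  | zero => exact ⟨τ, hτ, by simp⟩
  | succ m ih =>
    obtain ⟨τ', h1, h2⟩ := ih
    refine ⟨fun i => τ' (i + 1), fun i => h1 _, ?_⟩
    rw [← mul_inv_eq_of_eq_mul (gMat_mul_dMat ϖ τ'), ← h2, add_comm, zpow_add, zpow_one]
    group
  | pred m ih =>
    obtain ⟨τ', h1, h2⟩ := ih
    refine ⟨fun i => τ' (i - 1), fun i => h1 _, ?_⟩
    have h3 := gMat_mul_dMat ϖ fun i => τ' (i - 1)
    simp only [add_sub_cancel_right] at h3
    rw [eq_inv_mul_of_mul_eq h3, ← h2, sub_eq_add_neg, add_comm, zpow_add, zpow_neg_one]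
    group

/-- Conjugation scales the (i, j) entry by the unit τ_i / τ_j and fixes the diagonal, so no
valuation condition changes. -/
theorem conj_dMat_mem {τ : Fin n → Fˣ} (hτ : ∀ i, valuation F (τ i : F) = 1) {k : GL (Fin n) F}
    (hk : k ∈ iwahoriPlus n F) : dMat τ * k * (dMat τ)⁻¹ ∈ iwahoriPlus n F := by
  have hent : ∀ i j, (dMat τ * k * (dMat τ)⁻¹ : GL (Fin n) F) i j =
      τ i * k i j * (τ j : F)⁻¹ := by
    intro i j
    rw [← map_inv, mul_dMat_apply, dMat_mul_apply]
    simp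
  rw [mem_iwahoriPlus] at hk ⊢
  refine ⟨fun i j => ?_, fun i j hij => ?_⟩
  · rw [hent]
    simpa [hτ] using hk.1 i j
  · have h : (dMat τ * k * (dMat τ)⁻¹ : GL (Fin n) F) i j - (1 : Matrix (Fin n) (Fin n) F) i j =
        τ i * (k i j - (1 : Matrix (Fin n) (Fin n) F) i j) * (τ j : F)⁻¹ := by
      rw [hent]
      rcases eq_or_ne i j with rfl | hne
      · simp [mul_sub, sub_mul]
      · simp [Matrix.one_apply_ne hne]
    rw [h]
    simpa [hτ] using hk.2 i j hij

/-- The standard Iwahori subgroup, as the product of `I⁺` and the integral diagonal torus. -/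
def iwahori (n : ℕ) [n.AtLeastTwo] (F : Type*) [Field F] [ValuativeRel F] :
    Subgroup (GL (Fin n) F) where
  carrier := {x | ∃ τ : Fin n → Fˣ, (∀ i, valuation F (τ i : F) = 1) ∧
    ∃ k ∈ iwahoriPlus n F, x = dMat τ * k}
  one_mem' := ⟨1, by simp, 1, one_mem _, by simp⟩
  mul_mem' := by
    rintro _ _ ⟨τ, hτ, k, hk, rfl⟩ ⟨τ', hτ', k', hk', rfl⟩
    have h := conj_dMat_mem (τ := τ'⁻¹) (by simpa using hτ') hk
    refine ⟨τ * τ', by simp [hτ, hτ'], _, mul_mem h hk', ?_⟩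
    rw [map_mul, map_inv]
    group
  inv_mem' := by
    rintro _ ⟨τ, hτ, k, hk, rfl⟩
    refine ⟨τ⁻¹, by simpa using hτ, _, conj_dMat_mem hτ (inv_mem hk), ?_⟩
    rw [map_inv]
    group

theorem iwahoriPlus_le_iwahori : iwahoriPlus n F ≤ iwahori n F := fun k hk =>
  ⟨1, by simp, k, hk, by simp⟩

theorem dMat_mem_iwahori {τ : Fin n → Fˣ} (hτ : ∀ i, valuation F (τ i : F) = 1) :
    dMat τ ∈ iwahori n F :=
  ⟨τ, hτ, 1, one_mem _, by simp⟩

theorem valuation_diag {k : GL (Fin n) F} (hk : k ∈ iwahori n F) (i : Fin n) :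
    valuation F (k i i) = 1 := by
  obtain ⟨τ, hτ, k, hk, rfl⟩ := hk
  have := ((mem_iwahoriPlus k).1 hk).2 i i le_rfl
  rw [Matrix.one_apply_eq] at this
  rw [dMat_mul_apply, map_mul, hτ, val_eq_one_of_sub this, one_mul]

theorem diag_ne_zero {k : GL (Fin n) F} (hk : k ∈ iwahori n F) (i : Fin n) : k i i ≠ 0 := by
  intro h
  have := valuation_diag hk i
  simp [h] at this

theorem valuation_le_one {k : GL (Fin n) F} (hk : k ∈ iwahori n F) (i j : Fin n) :
    valuation F (k i j) ≤ 1 := by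
  obtain ⟨τ, hτ, k, hk, rfl⟩ := hk
  rw [dMat_mul_apply, map_mul, hτ, one_mul]
  exact ((mem_iwahoriPlus k).1 hk).1 i j

theorem zpow_conj_iwahori {ϖ : Fˣ} (hϖ : IsUniformizer ϖ) (j : ℤ) {k : GL (Fin n) F}
    (hk : k ∈ iwahori n F) : gMat n ϖ ^ j * k * (gMat n ϖ ^ j)⁻¹ ∈ iwahori n F := by
  obtain ⟨τ, hτ, k, hk, rfl⟩ := hk
  obtain ⟨τ', hτ', h⟩ := zpow_conj_dMat ϖ j hτ
  refine ⟨τ', hτ', _, (zpow_conj_gMat hϖ j hk).1, ?_⟩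
  rw [← h]
  group

/-- The normalizer `⟨g_ϖ⟩ Z I` of the Iwahori subgroup `I`. -/
def iwahoriNormalizer {ϖ : Fˣ} (hϖ : IsUniformizer ϖ) : Subgroup (GL (Fin n) F) where
  carrier := {x | ∃ (j : ℤ) (z : Fˣ), ∃ k ∈ iwahori n F, x = gMat n ϖ ^ j * zMat n z * k}
  one_mem' := ⟨0, 1, 1, one_mem _, by simp⟩
  mul_mem' := by
    rintro _ _ ⟨j, z, k, hk, rfl⟩ ⟨j', z', k', hk', rfl⟩
    exact ⟨j + j', z * z', _, mul_mem (zpow_conj_iwahori hϖ (-j') hk) hk',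
      group_mul_form _ _ _ _ _ _ _⟩
  inv_mem' := by
    rintro _ ⟨j, z, k, hk, rfl⟩
    exact ⟨-j, z⁻¹, _, zpow_conj_iwahori hϖ j (inv_mem hk), group_inv_form _ _ _ _⟩

theorem valuation_uniformizer_eq {ϖ ϖ' : Fˣ} (hϖ : IsUniformizer ϖ) (hϖ' : IsUniformizer ϖ') :
    valuation F (ϖ : F) = valuation F (ϖ' : F) :=
  le_antisymm ((hϖ' _).1 ((hϖ _).2 le_rfl)) ((hϖ _).1 ((hϖ' _).2 le_rfl))

/-- One has g_ϖ' = g_ϖ · diag(ϖ'/ϖ, 1, …, 1). The unit ϖ'/ϖ need not be congruent to 1 modulo 𝔭,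
which is why the full Iwahori subgroup is needed in place of I⁺. -/
theorem gMat_mem_iwahoriNormalizer {ϖ ϖ' : Fˣ} (hϖ : IsUniformizer ϖ) (hϖ' : IsUniformizer ϖ') :
    gMat n ϖ' ∈ iwahoriNormalizer (n := n) hϖ := by
  let τ : Fin n → Fˣ := fun j => if j = 0 then ϖ' * ϖ⁻¹ else 1
  have hτ : ∀ i, valuation F (τ i : F) = 1 := by
    intro i
    simp only [τ]
    split_ifs
    · simp [valuation_uniformizer_eq hϖ hϖ']
    · simp
  refine ⟨1, 1, dMat τ, dMat_mem_iwahori hτ, ?_⟩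
  have h1 : zMat n (1 : Fˣ) = 1 := map_one _
  rw [h1, mul_one, zpow_one]
  apply Matrix.GeneralLinearGroup.ext
  intro i j
  rw [mul_dMat_apply]
  simp only [gMat, Matrix.of_apply, τ, weight]
  split_ifs <;> simp [mul_comm (ϖ' : F)]

/-- This gives elements of a group known only by generators the explicit form g^j z k, used both for
compactness modulo Z and for the intersection with U. -/
theorem jointGroup_le {ϖ₁ ϖ₂ : Fˣ} (h₁ : IsUniformizer ϖ₁) (h₂ : IsUniformizer ϖ₂) :
    jointGroup n ϖ₁ ϖ₂ ≤ iwahoriNormalizer h₁ := by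
  refine sup_le (sup_le ?_ ?_) fun k hk => ⟨0, 1, k, iwahoriPlus_le_iwahori hk, by simp⟩
  · rw [Subgroup.closure_le]
    rintro _ (rfl | rfl)
    · exact gMat_mem_iwahoriNormalizer h₁ h₁
    · exact gMat_mem_iwahoriNormalizer h₁ h₂
  · rw [Matrix.GeneralLinearGroup.center_eq_range_scalar]
    rintro _ ⟨z, rfl⟩
    exact ⟨0, z, 1, one_mem _, by simp⟩

theorem zMat_mem_jointGroup (ϖ₁ ϖ₂ z : Fˣ) : zMat n z ∈ jointGroup n ϖ₁ ϖ₂ := by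
  refine Subgroup.mem_sup_left (Subgroup.mem_sup_right ?_)
  rw [Matrix.GeneralLinearGroup.center_eq_range_scalar]
  exact ⟨z, rfl⟩

theorem iwahoriPlus_le_jointGroup (ϖ₁ ϖ₂ : Fˣ) : iwahoriPlus n F ≤ jointGroup n ϖ₁ ϖ₂ :=
  le_sup_right

theorem Datum.group_le {D : Datum F n} {K : Subgroup (GL (Fin n) F)} (hg : gMat n D.ϖ ∈ K)
    (hz : ∀ z, zMat n z ∈ K) (hk : iwahoriPlus n F ≤ K) : D.group ≤ K := by
  rintro _ ⟨j, z, k, hk', rfl⟩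
  exact mul_mem (mul_mem (zpow_mem hg j) (hz z)) (hk hk')

theorem group_le_jointGroup (D₁ D₂ : Datum F n) : D₁.group ≤ jointGroup n D₁.ϖ D₂.ϖ :=
  Datum.group_le (Subgroup.mem_sup_left (Subgroup.mem_sup_left (Subgroup.subset_closure (.inl rfl))))
    (zMat_mem_jointGroup _ _) (iwahoriPlus_le_jointGroup _ _)

theorem jointGroup_comm (ϖ₁ ϖ₂ : Fˣ) :
    jointGroup (F := F) n ϖ₁ ϖ₂ = jointGroup n ϖ₂ ϖ₁ := by
  rw [jointGroup, jointGroup, Set.pair_comm]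

theorem iwahoriPlus_le_group (D : Datum F n) : iwahoriPlus n F ≤ D.group := fun k hk =>
  ⟨0, 1, k, hk, by simp⟩

theorem zMat_mem_group (D : Datum F n) (z : Fˣ) : zMat n z ∈ D.group :=
  ⟨0, z, 1, one_mem _, by simp⟩

/-! ### Intersections with the mirabolic subgroup and with U -/

/-- Reducing the exponent of `g_ϖ` modulo `n`. -/
theorem exists_gMat_pow_form (ϖ : Fˣ) (j : ℤ) (z : Fˣ) :
    ∃ r < n, ∃ c : Fˣ, ∀ k : GL (Fin n) F,
      gMat n ϖ ^ j * zMat n z * k = gMat n ϖ ^ r * (zMat n c * k) := by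
  have hn : (0 : ℤ) < n := by exact_mod_cast NeZero.pos n
  have h0 := Int.emod_nonneg j hn.ne'
  have h1 := Int.emod_lt_of_pos j hn
  refine ⟨(j % n).toNat, by omega, ϖ ^ (j / n) * z, fun k => ?_⟩
  have h2 : gMat n ϖ ^ j = gMat n ϖ ^ (j % n).toNat * zMat n (ϖ ^ (j / n)) := by
    have h3 : zMat n (ϖ ^ (j / n)) = zMat n ϖ ^ (j / n) := map_zpow _ _ _
    rw [h3, ← gMat_pow_n, ← zpow_natCast, ← zpow_natCast, ← zpow_mul, ← zpow_add,
      Int.toNat_of_nonneg h0, Int.emod_add_mul_ediv]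
  have h4 : zMat n (ϖ ^ (j / n) * z) = zMat n (ϖ ^ (j / n)) * zMat n z := map_mul _ _ _
  rw [h2, h4]
  group

open scoped Fin.CommRing in
/-- An element of the mirabolic subgroup in `⟨g_ϖ⟩ Z I` lies in `Z I`. -/
theorem eq_zMat_mul_of_mem_mirabolic (ϖ : Fˣ) (j : ℤ) (z : Fˣ) {k : GL (Fin n) F}
    (hk : k ∈ iwahori n F) (hp : gMat n ϖ ^ j * zMat n z * k ∈ mirabolic n F) :
    ∃ c : Fˣ, gMat n ϖ ^ j * zMat n z * k = zMat n c * k ∧ (c : F) * k (-1) (-1) = 1 := by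
  obtain ⟨r, hr, c, hc⟩ := exists_gMat_pow_form (n := n) ϖ j z
  rw [hc] at hp ⊢
  have hi : (-1 : Fin n) + 1 = 0 := neg_add_cancel 1
  have hlast := hp (-1) ((fin_succ_eq_zero (-1 : Fin n)).1 hi)
  -- Here -1 is the last index. The last row of g^r c k is a nonzero multiple of row -1 + r of k,
  -- whose diagonal entry is nonzero; for 0 < r < n it sits in a column where the last row must
  -- vanish.
  have hr0 : r = 0 := by
    by_contra hr0
    have hcast : ((r : ℕ) : Fin n) ≠ 0 := by
      intro h
      have := congrArg Fin.val h
      rw [Fin.val_natCast, Nat.mod_eq_of_lt hr] at this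
      exact hr0 (by simpa using this)
    have hl : (-1 : Fin n) + (r : Fin n) ≠ -1 := by simpa using hcast
    have h0 := hlast (-1 + (r : Fin n))
    rw [Matrix.one_apply_ne hl.symm, gMat_pow_mul_apply, zMat_mul_apply] at h0
    refine mul_ne_zero ?_ (mul_ne_zero c.ne_zero (diag_ne_zero hk _)) h0
    exact Finset.prod_ne_zero_iff.2 fun t _ => weight_ne_zero _ _
  subst hr0
  rw [pow_zero, one_mul] at hlast ⊢
  refine ⟨c, rfl, ?_⟩
  rw [← zMat_mul_apply, hlast, Matrix.one_apply_eq]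

theorem upperUnipotent_subset_mirabolic {u : GL (Fin n) F} (hu : u ∈ upperUnipotent n F) :
    u ∈ mirabolic n F := by
  intro i hi j
  refine hu i j ?_
  have := j.2
  rw [Fin.le_def]
  omega

theorem mul_mem_mirabolic {u g : GL (Fin n) F} (hu : u ∈ mirabolic n F)
    (hg : g ∈ mirabolic n F) : u * g ∈ mirabolic n F := by
  intro i hi j
  change ((u : Matrix (Fin n) (Fin n) F) * (g : Matrix (Fin n) (Fin n) F)) i j = _
  rw [← hg i hi j, Matrix.mul_apply, Finset.sum_eq_single i, hu i hi i, Matrix.one_apply_eq,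
    one_mul]
  · intro l _ hl
    rw [hu i hi l, Matrix.one_apply_ne hl.symm, zero_mul]
  · simp

/-- As U ⊆ P_n, the element is c k with k ∈ I and c k_{nn} = 1. So c is a unit and all entries are
integral, which for a unipotent upper triangular matrix means membership in I⁺. -/
theorem upperUnipotent_inf_iwahoriNormalizer_le {ϖ : Fˣ} (hϖ : IsUniformizer ϖ)
    {u : GL (Fin n) F} (hu : u ∈ upperUnipotent n F) (hK : u ∈ iwahoriNormalizer hϖ) :
    u ∈ iwahoriPlus n F := by
  obtain ⟨j, z, k, hk, rfl⟩ := hK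
  obtain ⟨c, h, hc⟩ := eq_zMat_mul_of_mem_mirabolic ϖ j z hk (upperUnipotent_subset_mirabolic hu)
  rw [h] at hu ⊢
  have hv : valuation F (c : F) = 1 := by
    have := congrArg (valuation F) hc
    rwa [map_mul, valuation_diag hk, mul_one, map_one] at this
  rw [mem_iwahoriPlus]
  refine ⟨fun i j => ?_, fun i j hij => ?_⟩
  · rw [zMat_mul_apply, map_mul, hv, one_mul]
    exact valuation_le_one hk i j
  · rw [hu i j hij]
    simp

/-- The element is c k with c k_{nn} = 1. Now k ∈ I⁺, so c lies in 1 + 𝔭 and the scalar matrix c is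
itself in I⁺. -/
theorem group_inf_mirabolic_le (D : Datum F n) {p : GL (Fin n) F} (hp : p ∈ mirabolic n F)
    (hD : p ∈ D.group) : p ∈ iwahoriPlus n F := by
  obtain ⟨j, z, k, hk, rfl⟩ := hD
  obtain ⟨c, h, hc⟩ := eq_zMat_mul_of_mem_mirabolic D.ϖ j z (iwahoriPlus_le_iwahori hk) hp
  rw [h]
  refine mul_mem ?_ hk
  have hd : valuation F (k (-1) (-1) - 1) < 1 := by
    simpa using ((mem_iwahoriPlus k).1 hk).2 (-1) (-1) le_rfl
  have hv : valuation F (c : F) = 1 := by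
    have := congrArg (valuation F) hc
    rwa [map_mul, val_eq_one_of_sub hd, mul_one, map_one] at this
  have hc1 : valuation F ((c : F) - 1) < 1 := by
    have e : (c : F) - 1 = -(c * (k (-1) (-1) - 1)) := by rw [mul_sub, hc]; ring
    rw [e, Valuation.map_neg, map_mul, hv, one_mul]
    exact hd
  have hent : ∀ i j, zMat n c i j = c * (1 : Matrix (Fin n) (Fin n) F) i j := fun i j => by
    simpa using zMat_mul_apply c (1 : GL (Fin n) F) i j
  rw [mem_iwahoriPlus]
  refine ⟨fun i j => ?_, fun i j _ => ?_⟩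
  · rw [hent, Matrix.one_apply]
    split_ifs <;> simp [hv]
  · rw [hent, Matrix.one_apply]
    split_ifs
    · simpa using hc1
    · simp

/-- On the mirabolic part of `I⁺` the affine generic character is `ψ_U`. -/
theorem affineSum_eq_of_mem_mirabolic (ϖ : Fˣ) {k : GL (Fin n) F} (hk : k ∈ mirabolic n F) :
    affineSum ϖ k = ∑ i : Fin n, if i + 1 = 0 then 0 else k i (i + 1) := by
  refine Finset.sum_congr rfl fun i _ => ?_
  split_ifs with hi
  · rw [hk i ((fin_succ_eq_zero i).1 hi), Matrix.one_apply_ne (succ_ne_self i).symm, zero_div]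
  · simp [weight, hi]

/-! ### Values of χ and W, and agreement on the mirabolic subgroup -/

theorem Datum.char_of_mem_iwahoriPlus {ψ : AddChar F ℂ} (hψ : IsLevelOne ψ) (D : Datum F n)
    (x : D.group) (hx : (x : GL (Fin n) F) ∈ iwahoriPlus n F) :
    D.char hψ x = ψ (affineSum D.ϖ (x : GL (Fin n) F)) :=
  (D.charVal_eq hψ x (j := 0) (z := 1) hx (by simp)).trans (by simp)

theorem Datum.char_of_mem_mirabolic {ψ : AddChar F ℂ} (hψ : IsLevelOne ψ) (D : Datum F n)
    (x : D.group) (hx : (x : GL (Fin n) F) ∈ mirabolic n F) :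
    D.char hψ x = psiU ψ (x : GL (Fin n) F) := by
  rw [D.char_of_mem_iwahoriPlus hψ x (group_inf_mirabolic_le D hx x.2),
    affineSum_eq_of_mem_mirabolic _ hx, psiU]

theorem Datum.char_zMat {ψ : AddChar F ℂ} (hψ : IsLevelOne ψ) (D : Datum F n) (z : Fˣ) :
    D.char hψ ⟨zMat n z, zMat_mem_group D z⟩ = D.ω z := by
  refine (D.charVal_eq hψ _ (j := 0) (z := z) (one_mem _) (by simp)).trans ?_
  have : affineSum D.ϖ (1 : GL (Fin n) F) = 0 := by
    refine Finset.sum_eq_zero fun i _ => ?_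
    have : (1 : GL (Fin n) F) i (i + 1) = 0 := Matrix.one_apply_ne (succ_ne_self i).symm
    rw [this, zero_div]
  simp [this]

theorem Datum.whittaker_eq_zero {ψ : AddChar F ℂ} (hψ : IsLevelOne ψ) (D : Datum F n)
    {g : GL (Fin n) F} (hg : ¬ ∃ (u : upperUnipotent n F) (h : D.group), g = u * h) :
    D.whittaker hψ g = 0 := dif_neg hg

theorem Datum.whittaker_of_mem_group {ψ : AddChar F ℂ} (hψ : IsLevelOne ψ) (D : Datum F n)
    (h : D.group) : D.whittaker hψ h = D.char hψ h := by
  have := D.whittaker_mul hψ 1 h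
  rwa [OneMemClass.coe_one, one_mul, psiU_one, one_mul] at this

/-- If p = u h then h = u⁻¹ p lies in P_n ∩ H₁' ⊆ I⁺ ⊆ H₂'. The same decomposition computes both
functions, and both characters equal ψ_U at h. -/
theorem whittaker_eq_of_mem_mirabolic_of_mem {ψ : AddChar F ℂ} (hψ : IsLevelOne ψ)
    (D₁ D₂ : Datum F n) {p : GL (Fin n) F} (hp : p ∈ mirabolic n F)
    (h : ∃ (u : upperUnipotent n F) (h : D₁.group), p = u * h) :
    D₁.whittaker hψ p = D₂.whittaker hψ p := by
  obtain ⟨u, h, rfl⟩ := h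
  have hm : (h : GL (Fin n) F) ∈ mirabolic n F := by
    simpa using mul_mem_mirabolic (upperUnipotent_subset_mirabolic (inv_mem u.2)) hp
  have h2 : (h : GL (Fin n) F) ∈ D₂.group :=
    iwahoriPlus_le_group D₂ (group_inf_mirabolic_le D₁ hm h.2)
  rw [D₁.whittaker_mul hψ u h, D₂.whittaker_mul hψ u ⟨h, h2⟩, D₁.char_of_mem_mirabolic hψ h hm,
    D₂.char_of_mem_mirabolic hψ ⟨h, h2⟩ hm]

theorem whittaker_eq_of_mem_mirabolic {ψ : AddChar F ℂ} (hψ : IsLevelOne ψ) (D₁ D₂ : Datum F n)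
    {p : GL (Fin n) F} (hp : p ∈ mirabolic n F) : D₁.whittaker hψ p = D₂.whittaker hψ p := by
  by_cases h1 : ∃ (u : upperUnipotent n F) (h : D₁.group), p = u * h
  · exact whittaker_eq_of_mem_mirabolic_of_mem hψ D₁ D₂ hp h1
  by_cases h2 : ∃ (u : upperUnipotent n F) (h : D₂.group), p = u * h
  · exact (whittaker_eq_of_mem_mirabolic_of_mem hψ D₂ D₁ hp h2).symm
  rw [D₁.whittaker_eq_zero hψ h1, D₂.whittaker_eq_zero hψ h2]

end Iwahori

/-! ## Topology of the groups -/

section Topology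

variable {F : Type*} [Field F] [ValuativeRel F] [TopologicalSpace F] [IsNonarchimedeanLocalField F]
variable {n : ℕ}

theorem continuous_entry (i j : Fin n) : Continuous fun g : GL (Fin n) F => g i j :=
  (Units.continuous_val (M := Matrix (Fin n) (Fin n) F)).matrix_elem i j

open Topology in
theorem eventually_valuation_sub_one_lt (i j : Fin n) {a : F} (ha : a ≠ 0) :
    ∀ᶠ g : GL (Fin n) F in 𝓝 1,
      valuation F (g i j - (1 : Matrix (Fin n) (Fin n) F) i j) < valuation F a := by
  have hc : Continuous fun g : GL (Fin n) F =>
      g i j - (1 : Matrix (Fin n) (Fin n) F) i j := (continuous_entry i j).sub continuous_const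
  have h := hc.tendsto (1 : GL (Fin n) F)
  have h0 : (1 : GL (Fin n) F) i j - (1 : Matrix (Fin n) (Fin n) F) i j = 0 := sub_self _
  rw [h0] at h
  exact h ((IsValuativeTopology.hasBasis_nhds_zero' F).mem_of_mem
    (i := valuation F a) (by simpa using ha))

open Topology in
-- It contains the neighbourhood of 1 formed by the matrices congruent to 1 modulo 𝔭.
theorem isOpen_iwahoriPlus : IsOpen (iwahoriPlus n F : Set (GL (Fin n) F)) := by
  have h : ∀ᶠ g : GL (Fin n) F in 𝓝 1, ∀ i j,
      valuation F (g i j - (1 : Matrix (Fin n) (Fin n) F) i j) < valuation F (1 : F) :=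
    Filter.eventually_all.2 fun i => Filter.eventually_all.2 fun j =>
      eventually_valuation_sub_one_lt i j one_ne_zero
  refine Subgroup.isOpen_of_mem_nhds _ (g := 1) (h.mono fun g hg => ?_)
  simp only [map_one] at hg
  refine (mem_iwahoriPlus g).2 ⟨fun i j => ?_, fun i j _ => hg i j⟩
  have h1 : valuation F ((1 : Matrix (Fin n) (Fin n) F) i j) ≤ 1 := by
    rw [Matrix.one_apply]
    split_ifs <;> simp
  rw [← sub_add_cancel (g i j) ((1 : Matrix (Fin n) (Fin n) F) i j)]
  exact (valuation F).map_add_le (hg i j).le h1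

/-- Separation is used to pass from compactness of the matrix ring over 𝔬 to compactness of its unit
group. -/
theorem t1Space_of_isNonarchimedeanLocalField : T1Space F := by
  let := IsTopologicalAddGroup.rightUniformSpace F
  have := isUniformAddGroup_of_addCommGroup (G := F)
  infer_instance

/-- `GL_n(𝔬)` as a subset of `GL_n(F)`. -/
theorem isCompact_integralPoints : IsCompact (Set.range
    (Matrix.GeneralLinearGroup.map (n := Fin n) (valuation F).integer.subtype)) := by
  have := t1Space_of_isNonarchimedeanLocalField (F := F)
  have : T1Space (Matrix (Fin n) (Fin n) (valuation F).integer) :=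
    inferInstanceAs (T1Space (Fin n → Fin n → (valuation F).integer))
  have : CompactSpace (Matrix (Fin n) (Fin n) (valuation F).integer) :=
    inferInstanceAs (CompactSpace (Fin n → Fin n → (valuation F).integer))
  have : CompactSpace (GL (Fin n) (valuation F).integer) :=
    inferInstanceAs (CompactSpace (Matrix (Fin n) (Fin n) (valuation F).integer)ˣ)
  refine isCompact_range (Continuous.units_map _ ?_)
  exact continuous_id.matrix_map continuous_subtype_val

variable [n.AtLeastTwo]

theorem isOpen_group (D : Datum F n) : IsOpen (D.group : Set (GL (Fin n) F)) :=
  Subgroup.isOpen_mono (iwahoriPlus_le_group D) isOpen_iwahoriPlus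

theorem dMat_mem_integralPoints {τ : Fin n → Fˣ} (hτ : ∀ i, valuation F (τ i : F) = 1) :
    dMat τ ∈ Set.range
      (Matrix.GeneralLinearGroup.map (n := Fin n) (valuation F).integer.subtype) := by
  let σ : Fin n → (valuation F).integerˣ := fun i =>
    { val := ⟨τ i, (hτ i).le⟩
      inv := ⟨((τ i)⁻¹ : Fˣ), by
        change valuation F _ ≤ 1
        simp [hτ i]⟩
      val_inv := Subtype.ext (by simp)
      inv_val := Subtype.ext (by simp) }
  refine ⟨dMat σ, ?_⟩
  apply Matrix.GeneralLinearGroup.ext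
  intro i j
  change ((Matrix.diagonal fun i => (σ i : (valuation F).integer)) i j : F) =
    Matrix.diagonal (fun i => (τ i : F)) i j
  simp only [Matrix.diagonal_apply]
  split_ifs <;> rfl

theorem iwahori_subset_integralPoints : (iwahori n F : Set (GL (Fin n) F)) ⊆ Set.range
    (Matrix.GeneralLinearGroup.map (n := Fin n) (valuation F).integer.subtype) := by
  rintro _ ⟨τ, hτ, k, ⟨k', -, rfl⟩, rfl⟩
  obtain ⟨σ, hσ⟩ := dMat_mem_integralPoints hτ
  exact ⟨σ * k', by rw [map_mul, hσ]⟩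

/-- Modulo Z every element has the form g^r k with 0 ≤ r < n and k ∈ GL_n(𝔬), so the image lies in a
finite union of compact sets. -/
theorem isOpenCompactModCenter_jointGroup {ϖ₁ ϖ₂ : Fˣ} (h₁ : IsUniformizer ϖ₁)
    (h₂ : IsUniformizer ϖ₂) : IsOpenCompactModCenter (jointGroup (F := F) n ϖ₁ ϖ₂) := by
  have hopen : IsOpen (jointGroup n ϖ₁ ϖ₂ : Set (GL (Fin n) F)) :=
    Subgroup.isOpen_mono (iwahoriPlus_le_jointGroup _ _) isOpen_iwahoriPlus
  refine ⟨hopen, le_sup_of_le_left le_sup_right, ?_⟩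
  have hcomp : IsCompact (⋃ r ∈ Set.Iio n,
      (fun g : GL (Fin n) F => ((gMat n ϖ₁ ^ r * g : GL (Fin n) F) :
        GL (Fin n) F ⧸ Subgroup.center (GL (Fin n) F))) '' Set.range
          (Matrix.GeneralLinearGroup.map (n := Fin n) (valuation F).integer.subtype)) :=
    (Set.finite_Iio n).isCompact_biUnion fun r _ => isCompact_integralPoints.image
      (QuotientGroup.continuous_mk.comp (continuous_const_mul _))
  refine hcomp.of_isClosed_subset ?_ ?_
  -- The image in G/Z is an open subgroup, hence closed.
  · exact Subgroup.isClosed_of_isOpen ((jointGroup n ϖ₁ ϖ₂).map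
      (QuotientGroup.mk' (Subgroup.center (GL (Fin n) F)))) (QuotientGroup.isOpenMap_coe _ hopen)
  · rintro _ ⟨x, hx, rfl⟩
    obtain ⟨j, z, k, hk, rfl⟩ := jointGroup_le h₁ h₂ hx
    obtain ⟨r, hr, c, hc⟩ := exists_gMat_pow_form (n := n) ϖ₁ j z
    refine Set.mem_biUnion hr ⟨k, iwahori_subset_integralPoints hk, ?_⟩
    rw [hc, QuotientGroup.eq, Matrix.GeneralLinearGroup.center_eq_range_scalar]
    refine ⟨c, ?_⟩
    change zMat n c = _
    rw [zMat_comm]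
    group

end Topology

/-! ## Unitarity of the character -/

section Unitary

variable {F : Type*} [Field F] [ValuativeRel F] {n : ℕ} [n.AtLeastTwo]

/-- The cardinality m of the residue field kills 𝔬/𝔭, so ψ(x)^m = ψ(m x) = 1 and ψ(x) is a root of
unity. -/
theorem norm_eq_one_of_valuation_le_one
    [Finite (IsLocalRing.ResidueField (valuation F).integer)] {ψ : AddChar F ℂ}
    (hψ : IsLevelOne ψ) {x : F} (hx : valuation F x ≤ 1) : ‖ψ x‖ = 1 := by
  have := Fintype.ofFinite (IsLocalRing.ResidueField (valuation F).integer)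
  set m := Fintype.card (IsLocalRing.ResidueField (valuation F).integer) with hm
  have h0 : IsLocalRing.residue (valuation F).integer (m • ⟨x, hx⟩) = 0 := by
    rw [map_nsmul, nsmul_eq_mul, hm, Nat.cast_card_eq_zero, zero_mul]
  have h1 := hψ.1 _ ((residue_eq_zero_iff _).1 h0)
  have h2 : ψ (m • x) = 1 := by simpa using h1
  rw [AddChar.map_nsmul_eq_pow] at h2
  exact Complex.norm_eq_one_of_pow_eq_one h2 Fintype.card_ne_zero

theorem valuation_affineSum_le_one {ϖ : Fˣ} (hϖ : IsUniformizer ϖ) {k : GL (Fin n) F}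
    (hk : k ∈ iwahoriPlus n F) : valuation F (affineSum ϖ k) ≤ 1 :=
  (valuation F).map_sum_le fun i _ => entry_div_le hϖ hk (succ_ne_self i).symm

/-- Each factor of ζ^j ω(z) ψ(…) has modulus one: ζ because ζ^n = ω(ϖ), and the last because its
argument is integral. -/
theorem Datum.norm_char [Finite (IsLocalRing.ResidueField (valuation F).integer)]
    {ψ : AddChar F ℂ} (hψ : IsLevelOne ψ) (D : Datum F n) (hω : ∀ z : Fˣ, ‖(D.ω z : ℂ)‖ = 1)
    (x : D.group) : ‖D.char hψ x‖ = 1 := by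
  obtain ⟨j, z, k, hk, hx⟩ := x.2
  have hζ : ‖(D.ζ : ℂ)‖ = 1 := by
    have h := hω D.ϖ
    rw [← D.ζ_pow, Units.val_pow_eq_pow_val, norm_pow] at h
    exact (pow_eq_one_iff_of_nonneg (norm_nonneg _) (NeZero.ne n)).1 h
  have h : D.char hψ x = _ := D.charVal_eq hψ x hk hx
  rw [h, norm_mul, norm_eq_one_of_valuation_le_one hψ (valuation_affineSum_le_one D.uniformizer hk),
    Units.val_mul, norm_mul, hω, Units.val_zpow_eq_zpow_val, norm_zpow, hζ]
  simp

end Unitary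

/-! ## The functions `W_{ϖ,ζ}` are Whittaker functions -/

section Special

variable {F : Type*} [Field F] [ValuativeRel F] {n : ℕ} [n.AtLeastTwo]

/-- `ψ_U` as a character of `U`. -/
def psiUHom (n : ℕ) [n.AtLeastTwo] (ψ : AddChar F ℂ) : upperUnipotent n F →* ℂ where
  toFun u := psiU ψ (u : GL (Fin n) F)
  map_one' := psiU_one ψ
  map_mul' u u' := psiU_mul ψ u.2 u'.2

theorem psiUHom_eq_char {ψ : AddChar F ℂ} (hψ : IsLevelOne ψ) (D : Datum F n)
    (u : upperUnipotent n F) (hu : (u : GL (Fin n) F) ∈ D.group) :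
    psiUHom n ψ u = D.char hψ ⟨u, hu⟩ :=
  (D.char_of_mem_mirabolic hψ ⟨u, hu⟩ (upperUnipotent_subset_mirabolic u.2)).symm

variable [TopologicalSpace F] [IsNonarchimedeanLocalField F]

open Topology in
-- Near 1 each entry in the affine sum is smaller than its weight, so the sum falls in 𝔭, where ψ is
-- trivial. This provides the smoothness of χ extended by zero.
theorem isOpen_ker_char {ψ : AddChar F ℂ} (hψ : IsLevelOne ψ) (D : Datum F n) :
    IsOpen ((((D.char hψ).ker).map D.group.subtype : Subgroup (GL (Fin n) F)) :
      Set (GL (Fin n) F)) := by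
  have h : ∀ᶠ g : GL (Fin n) F in 𝓝 1, ∀ i : Fin n,
      valuation F (g i (i + 1) - (1 : Matrix (Fin n) (Fin n) F) i (i + 1)) <
        valuation F (weight D.ϖ (i + 1)) :=
    Filter.eventually_all.2 fun i => eventually_valuation_sub_one_lt i (i + 1) (weight_ne_zero _ _)
  have hI : ∀ᶠ g : GL (Fin n) F in 𝓝 1, g ∈ iwahoriPlus n F :=
    isOpen_iwahoriPlus.mem_nhds (one_mem _)
  refine Subgroup.isOpen_of_mem_nhds _ (g := 1) ((h.and hI).mono fun g hg => ?_)
  refine ⟨⟨g, iwahoriPlus_le_group D hg.2⟩, ?_, rfl⟩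
  refine (D.char_of_mem_iwahoriPlus hψ _ hg.2).trans (hψ.1 _ ?_)
  refine (valuation F).map_sum_lt one_ne_zero fun i _ => ?_
  have := hg.1 i
  rw [Matrix.one_apply_ne (succ_ne_self i).symm, sub_zero] at this
  rw [map_div₀, div_lt_one₀ (by simpa [zero_lt_iff] using weight_ne_zero D.ϖ (i + 1))]
  exact this

theorem extendZero_char_mem {ψ : AddChar F ℂ} (hψ : IsLevelOne ψ) (D : Datum F n) :
    extendZero (D.char hψ) ∈ compactInd D.group (D.char hψ) := by
  refine extendZero_mem_compactInd (isOpen_ker_char hψ D) ?_ ?_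
  · rintro _ ⟨x, -, rfl⟩
    exact x.2
  · rintro x ⟨y, hy, h⟩
    rw [← Subtype.ext h]
    exact hy

theorem Datum.isWhittakerFunction {ψ : AddChar F ℂ} (hψ : IsLevelOne ψ) (D : Datum F n) :
    IsWhittakerFunction ψ (D.rep hψ) (D.whittaker hψ) := by
  have hf := extendZero_char_mem hψ D
  have hW : ∀ g, D.whittaker hψ g = whittakerFunctional D.group (D.char hψ) (psiUHom n ψ)
      (isOpen_group D) (D.rep hψ g ⟨_, hf⟩) := by
    intro g
    by_cases hg : ∃ (u : upperUnipotent n F) (h : D.group), g = u * h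
    · obtain ⟨u, h, rfl⟩ := hg
      rw [D.whittaker_mul hψ u h]
      exact (whittakerFunctional_extendZero (isOpen_group D) (psiUHom_eq_char hψ D) hf u h).symm
    · rw [D.whittaker_eq_zero hψ hg]
      exact (whittakerFunctional_extendZero_eq_zero (isOpen_group D) hf hg).symm
  refine ⟨_, fun h0 => ?_, fun u hu f =>
    whittakerFunctional_equivariant (isOpen_group D) (psiUHom_eq_char hψ D) ⟨u, hu⟩ f, _, hW⟩
  -- The functional is nonzero because W(1) = χ(1) = 1.
  have h1 := D.whittaker_of_mem_group hψ 1
  rw [hW, h0, map_one] at h1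
  exact zero_ne_one h1

theorem Datum.isKSpecial {ψ : AddChar F ℂ} (hψ : IsLevelOne ψ) (D₁ D₂ : Datum F n)
    (hω : ∀ z : Fˣ, ‖(D₁.ω z : ℂ)‖ = 1) :
    IsKSpecial ψ (D₁.rep hψ) (jointGroup n D₁.ϖ D₂.ϖ) (D₁.whittaker hψ) where
  compact_mod_center := isOpenCompactModCenter_jointGroup D₁.uniformizer D₂.uniformizer
  whittaker := D₁.isWhittakerFunction hψ
  ne_zero h0 := by
    have h1 := D₁.whittaker_of_mem_group hψ 1
    rw [h0, map_one] at h1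
    exact zero_ne_one h1
  support_subset g hg := by
    by_contra h
    refine hg (D₁.whittaker_eq_zero hψ ?_)
    rintro ⟨u, x, rfl⟩
    exact h ⟨u, u.2, x, group_le_jointGroup D₁ D₂ x.2, rfl⟩
  conj_symm k hk := by
    -- If x = u y ∈ K with y ∈ H' ⊆ K, then u ∈ U ∩ K ⊆ I⁺ ⊆ H', which forces x ∈ H'. So K ∩ U H' =
    -- H'.
    have hmem : ∀ x ∈ jointGroup n D₁.ϖ D₂.ϖ, x ∉ D₁.group → D₁.whittaker hψ x = 0 := by
      refine fun x hx hxD => D₁.whittaker_eq_zero hψ ?_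
      rintro ⟨u, y, rfl⟩
      refine hxD (mul_mem (iwahoriPlus_le_group D₁ ?_) y.2)
      refine upperUnipotent_inf_iwahoriNormalizer_le D₁.uniformizer u.2
        (jointGroup_le D₁.uniformizer D₂.uniformizer ?_)
      exact (Subgroup.mul_mem_cancel_right _ (group_le_jointGroup D₁ D₂ y.2)).1 hx
    by_cases hkD : k ∈ D₁.group
    · have h1 := D₁.whittaker_of_mem_group hψ ⟨k, hkD⟩
      have h2 := D₁.whittaker_of_mem_group hψ ⟨k, hkD⟩⁻¹
      have h3 : D₁.char hψ ⟨k, hkD⟩⁻¹ * D₁.char hψ ⟨k, hkD⟩ = 1 := by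
        rw [← map_mul, inv_mul_cancel, map_one]
      refine h2.trans ?_
      rw [h1, eq_inv_of_mul_eq_one_left h3, Complex.inv_eq_conj (D₁.norm_char hψ hω _)]
    · rw [hmem k hk hkD, hmem _ (inv_mem hk) (mt inv_mem_iff.1 hkD), map_zero]

end Special

/-! ## Transport along isomorphisms -/

section Transport

variable {F : Type*} [Field F] [ValuativeRel F] {n : ℕ} [n.AtLeastTwo]
variable {V V' : Type*} [AddCommGroup V] [Module ℂ V] [AddCommGroup V'] [Module ℂ V']
variable {π : Representation ℂ (GL (Fin n) F) V} {π' : Representation ℂ (GL (Fin n) F) V'}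

/-- The functional is pulled back along `e` and the vector along its inverse; the matrix coefficient
is unchanged. -/
theorem IsWhittakerFunction.of_equiv {ψ : AddChar F ℂ} {W : GL (Fin n) F → ℂ}
    (hW : IsWhittakerFunction ψ π' W) (e : π.Equiv π') : IsWhittakerFunction ψ π W := by
  obtain ⟨l, hl, hU, v, hv⟩ := hW
  have he : ∀ g v, e (π g v) = π' g (e v) := fun g v =>
    LinearMap.congr_fun (e.isIntertwining' g) v
  have hs : ∀ v, e (e.toLinearEquiv.symm v) = v := e.toLinearEquiv.apply_symm_apply
  refine ⟨l ∘ₗ e.toLinearEquiv.toLinearMap, fun h0 => hl ?_, fun u hu w => ?_,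
    e.toLinearEquiv.symm v, fun g => ?_⟩
  · ext w
    have := LinearMap.congr_fun h0 (e.toLinearEquiv.symm w)
    change l (e (e.toLinearEquiv.symm w)) = 0 at this
    rwa [hs] at this
  · change l (e (π u w)) = psiU ψ u * l (e w)
    rw [he, hU u hu]
  · change W g = l (e (π g (e.toLinearEquiv.symm v)))
    rw [he, hs, hv]

theorem IsKSpecial.of_equiv [TopologicalSpace F] {ψ : AddChar F ℂ} {W : GL (Fin n) F → ℂ}
    {K : Subgroup (GL (Fin n) F)} (hW : IsKSpecial ψ π' K W) (e : π.Equiv π') :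
    IsKSpecial ψ π K W :=
  { hW with whittaker := hW.whittaker.of_equiv e }

theorem HasCentralChar.of_equiv {ω : Fˣ →* ℂˣ} (h : HasCentralChar π ω) (e : π.Equiv π') :
    HasCentralChar π' ω := by
  intro z v
  have he := LinearMap.congr_fun (e.isIntertwining' (zMat n z)) (e.toLinearEquiv.symm v)
  change e (π _ (e.toLinearEquiv.symm v)) = π' _ (e (e.toLinearEquiv.symm v)) at he
  rw [h, map_smul] at he
  have hs : e (e.toLinearEquiv.symm v) = v := e.toLinearEquiv.apply_symm_apply v
  rw [hs] at he
  exact he.symm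

/-- Invariance of the inner product gives |ω(z)|² ⟨v, v⟩ = ⟨v, v⟩ for a nonzero v. -/
theorem HasCentralChar.norm_eq_one [Nontrivial V] {ω : Fˣ →* ℂˣ} (h : HasCentralChar π ω)
    (hu : IsUnitarizable π) (z : Fˣ) : ‖(ω z : ℂ)‖ = 1 := by
  obtain ⟨c, hc⟩ := hu
  obtain ⟨v, hv⟩ := exists_ne (0 : V)
  have hvv : c.inner v v ≠ 0 := mt (c.definite v) hv
  have h1 := hc (zMat n z) v v
  have h2 : c.inner ((ω z : ℂ) • v) ((ω z : ℂ) • v) =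
      (starRingEnd ℂ (ω z : ℂ) * (ω z : ℂ)) * c.inner v v := by
    rw [c.smul_left, ← c.conj_inner_symm, c.smul_left, map_mul, c.conj_inner_symm,
      Complex.conj_conj, mul_assoc]
  rw [h, h2] at h1
  have h3 := (mul_eq_right₀ hvv).1 h1
  rw [Complex.conj_mul', ← Complex.ofReal_pow, Complex.ofReal_eq_one] at h3
  exact (pow_eq_one_iff_of_nonneg (norm_nonneg _) two_ne_zero).1 h3

variable [TopologicalSpace F] [IsNonarchimedeanLocalField F]

theorem extendZero_char_one {ψ : AddChar F ℂ} (hψ : IsLevelOne ψ) (D : Datum F n) :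
    extendZero (D.char hψ) 1 = 1 :=
  (extendZero_of_mem (one_mem D.group)).trans (map_one (D.char hψ))

/-- Evaluate at 1 the action of z on χ extended by zero: one side is χ(z) = `D.ω z`, the other ω(z)
· 1. -/
theorem Datum.eq_ω {ψ : AddChar F ℂ} (hψ : IsLevelOne ψ) (D : Datum F n) {ω : Fˣ →* ℂˣ}
    (h : HasCentralChar (D.rep hψ) ω) : D.ω = ω := by
  ext z
  have h1 := congrFun (congrArg Subtype.val (h z ⟨_, extendZero_char_mem hψ D⟩)) 1
  change extendZero (D.char hψ) (1 * zMat n z) = (ω z : ℂ) * extendZero (D.char hψ) 1 at h1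
  rwa [one_mul, extendZero_of_mem (zMat_mem_group D z), D.char_zMat hψ, extendZero_char_one,
    mul_one] at h1

theorem IsSimpleSupercuspidal.nontrivial {ψ : AddChar F ℂ} {hψ : IsLevelOne ψ}
    (h : IsSimpleSupercuspidal hψ π) : Nontrivial V := by
  obtain ⟨D, ⟨e⟩⟩ := h
  have : Nontrivial (compactInd D.group (D.char hψ)) := by
    refine ⟨⟨_, extendZero_char_mem hψ D⟩, 0, fun h0 => ?_⟩
    have h1 := congrFun (congrArg Subtype.val h0) 1
    change extendZero (D.char hψ) 1 = 0 at h1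
    rw [extendZero_char_one] at h1
    exact one_ne_zero h1
  exact e.toLinearEquiv.toEquiv.nontrivial

end Transport

end

end SimpleSC

open SimpleSC in
/-- Simple supercuspidal representations of `GL_n(F)` with the same unitary central character admit
a special pair of Whittaker functions, given explicitly by `W_{ϖ₁,ζ₁}` and `W_{ϖ₂,ζ₂}`. -/
theorem theorem5p6 {F : Type*} [Field F] [CharZero F] [ValuativeRel F] [TopologicalSpace F]
    [IsNonarchimedeanLocalField F] (n : ℕ) [n.AtLeastTwo]
    (ψ : AddChar F ℂ) (hψ : IsLevelOne ψ) :
    (∀ D₁ D₂ : Datum F n, D₁.ω = D₂.ω → (∀ z : Fˣ, ‖(D₁.ω z : ℂ)‖ = 1) →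
      IsKSpecial ψ (D₁.rep hψ) (jointGroup n D₁.ϖ D₂.ϖ) (D₁.whittaker hψ) ∧
      IsKSpecial ψ (D₂.rep hψ) (jointGroup n D₁.ϖ D₂.ϖ) (D₂.whittaker hψ) ∧
      ∀ p ∈ mirabolic n F, D₁.whittaker hψ p = D₂.whittaker hψ p) ∧
    (∀ (V₁ V₂ : Type*) [AddCommGroup V₁] [Module ℂ V₁] [AddCommGroup V₂] [Module ℂ V₂]
      (π₁ : Representation ℂ (GL (Fin n) F) V₁) (π₂ : Representation ℂ (GL (Fin n) F) V₂)
      (ω : Fˣ →* ℂˣ),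
      π₁.IsIrreducible → π₂.IsIrreducible → IsUnitarizable π₁ → IsUnitarizable π₂ →
      IsSimpleSupercuspidal hψ π₁ → IsSimpleSupercuspidal hψ π₂ →
      HasCentralChar π₁ ω → HasCentralChar π₂ ω →
      ∃ W₁ W₂ : GL (Fin n) F → ℂ, IsSpecialPair ψ π₁ π₂ W₁ W₂) := by
  have hsp : ∀ D₁ D₂ : Datum F n, D₁.ω = D₂.ω → (∀ z : Fˣ, ‖(D₁.ω z : ℂ)‖ = 1) →
      IsKSpecial ψ (D₁.rep hψ) (jointGroup n D₁.ϖ D₂.ϖ) (D₁.whittaker hψ) ∧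
      IsKSpecial ψ (D₂.rep hψ) (jointGroup n D₁.ϖ D₂.ϖ) (D₂.whittaker hψ) ∧
      ∀ p ∈ mirabolic n F, D₁.whittaker hψ p = D₂.whittaker hψ p := by
    intro D₁ D₂ h hω
    refine ⟨D₁.isKSpecial hψ D₂ hω, ?_, fun p hp => whittaker_eq_of_mem_mirabolic hψ D₁ D₂ hp⟩
    -- K is symmetric in the two uniformizers, so the second claim is the first with the data
    -- exchanged.
    rw [jointGroup_comm]
    exact D₂.isKSpecial hψ D₁ (h ▸ hω)
  refine ⟨hsp, ?_⟩
  intro V₁ V₂ _ _ _ _ π₁ π₂ ω _ _ hu₁ _ hs₁ hs₂ hc₁ hc₂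
  have := hs₁.nontrivial
  obtain ⟨D₁, ⟨e₁⟩⟩ := hs₁
  obtain ⟨D₂, ⟨e₂⟩⟩ := hs₂
  have h₁ := D₁.eq_ω hψ (hc₁.of_equiv e₁)
  have h₂ := D₂.eq_ω hψ (hc₂.of_equiv e₂)
  -- Both data carry the common central character, and it is unitary because π₁ is nonzero and
  -- unitarizable.
  obtain ⟨hk₁, hk₂, hp⟩ := hsp D₁ D₂ (h₁.trans h₂.symm) (h₁ ▸ hc₁.norm_eq_one hu₁)
  exact ⟨_, _, _, hk₁.of_equiv e₁, hk₂.of_equiv e₂, hp⟩
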